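/- Let $m,n\ge 0$ be integers, $c\in\mathbb C\setminus\{0\}$, $\bar u=(u_1,\dots,u_m)\in\mathbb C^m$, $\bar v=(v_1,\dots,v_n)\in\mathbb C^n$, and put $$g(x,y)=\frac{c}{x-y},\qquad f(x,y)=\frac{x-y+c}{x-y},\qquad h(x,y)=\frac{x-y+c}{c}.$$ Let $R(x,y)=\frac{x-y}{c}I+P$ on $\mathbb C^2\otimes\mathbb C^2$, with $P$ the permutation operator. On $V_{a_1}\otimes\cdots\otimes V_{a_m}\otimes V_{b_1}\otimes\cdots\otimes V_{b_n}$, all factors equal to $\mathbb C^2$, let $\mathcal Z=\prod_{i=1}^{m}\prod_{j=1}^{n}R_{a_ib_j}(u_i,v_j)$ (both products ordered with increasing index from left to right). For $2\times2$ complex matrices $B,\hat B$ the twisted partition function of the inhomogeneous rational six-vertex model on the $m\times n$ lattice is $$Z_{mn}=\operatorname{tr}\Big(\prod_{j=1}^n\hat B_{b_j}\prod_{i=1}^m B_{a_i}\;\mathcal Z\Big).$$ Let $B(x)=\operatorname{tr}_a\big(B_a\,R_{ab_1}(x,v_1)\cdots R_{ab_n}(x,v_n)\big)$ and $\hat B(y)=\operatorname{tr}_b\big(\hat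 B_b\,R_{a_1b}(u_1,y)\cdots R_{a_mb}(u_m,y)\big)$ be the row and column transfer matrices. Let $w,e,\nu,s\in\mathbb C^2$, $B=|e\rangle\langle w|$ and $\hat B=|\nu\rangle\langle s|$ (that is, $B_{ij}=e_iw_j$ and $\hat B_{ij}=\nu_is_j$, without complex conjugation), and let $\langle W|=\langle w|^{\otimes m}$, $|E\rangle=|e\rangle^{\otimes m}$, $\langle S|=\langle s|^{\otimes n}$, $|N\rangle=|\nu\rangle^{\otimes n}$. Then $$Z_{mn}=\big(\langle W|\otimes\langle S|\big)\,\mathcal Z\,\big(|E\rangle\otimes|N\rangle\big)=\langle S|B(u_1)\cdots B(u_m)|N\rangle=\langle W|\hat B(v_1)\cdots\hat B(v_n)|E\rangle .$$ Suppose moreover that $u_i\ne v_j$ for all $i,j$ and that $\operatorname{tr}B$, $\operatorname{tr}\hat B$ and $\operatorname{tr}(B\hat B)$ are nonzero. With $\sigma_y=\begin{pmatrix}0&-i\\ i&0\end{pmatrix}$ put $$\beta=-\frac{\operatorname{tr}(B\sigma_y\hat B^{t}\sigma_y)}{\operatorname{tr}(B\hat B)},\qquad \chi=1-\beta,\qquad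 \lambda_2(\bar u)=\prod_{i=1}^m\prod_{j=1}^n\frac{1}{g(u_i,v_j)} .$$ (1) If the $v_j$ are pairwise distinct and $v_j-v_k+c\neq0$ for all $j,k$, then $$Z_{mn}=\frac{(\operatorname{tr}B)^m(\operatorname{tr}\hat B)^n}{\chi^n}\,\lambda_2(\bar u)\,K^{(\beta)}_{mn}(\bar u|\bar v),\qquad K^{(z)}_{mn}(\bar u|\bar v)=\det_{1\le j,k\le n}\Big(-z\,\delta_{jk}+\frac{\prod_{i}f(u_i,v_j)\prod_{l\ne j}f(v_j,v_l)}{h(v_j,v_k)}\Big),$$ where $K^{(z)}_{mn}$ is the modified Izergin determinant. (2) If the $u_j$ are pairwise distinct and $u_j-u_k+c\neq0$ for all $j,k$, then $$Z_{mn}=\frac{(\operatorname{tr}B)^m(\operatorname{tr}\hat B)^n}{\chi^m}\,\lambda_2(\bar u)\,\det_{1\le j,k\le m}\Big(\delta_{jk}\prod_{l}f(u_j,v_l)-\beta\,\frac{\prod_{i\neq j}f(u_j,u_i)}{h(u_j,u_k)}\Big).$$ (3) If the $v_j$ are pairwise distinct, then $$Z_{mn}=\frac{(\operatorname{tr}B)^m(\operatorname{tr}\hat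 B)^n}{\chi^n}\,\lambda_2(\bar u)\sum_{I\subseteq\{1,\dots,n\}}(-\beta)^{n-\#I}\prod_{i=1}^m\prod_{j\in I}f(u_i,v_j)\prod_{j\in I}\prod_{k\notin I}f(v_j,v_k).$$ (4) If the $u_i$ are pairwise distinct, then $$Z_{mn}=\frac{(\operatorname{tr}B)^m(\operatorname{tr}\hat B)^n}{\chi^m}\,\lambda_2(\bar u)\sum_{I\subseteq\{1,\dots,m\}}(-\beta)^{\#I}\prod_{i\notin I}\prod_{j=1}^n f(u_i,v_j)\prod_{i\in I}\prod_{k\notin I}f(u_i,u_k).$$ -/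

import Mathlib

open scoped Matrix

noncomputable section

namespace SixVertex

/-- Basis of `V_{a_1} ⊗ ⋯ ⊗ V_{a_m} ⊗ V_{b_1} ⊗ ⋯ ⊗ V_{b_n}`, every factor being `ℂ²`: a pair of
configurations of the `m` row spaces and of the `n` column spaces. -/
abbrev Conf (m n : ℕ) : Type := (Fin m → Fin 2) × (Fin n → Fin 2)

/-! ### The rational functions of the model -/

/-- `g(u,v) = c / (u - v)`. -/
def g (c u v : ℂ) : ℂ := c / (u - v)

/-- `f(u,v) = (u - v + c) / (u - v)`. -/
def f (c u v : ℂ) : ℂ := (u - v + c) / (u - v)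

/-- `h(u,v) = (u - v + c) / c`. -/
def h (c u v : ℂ) : ℂ := (u - v + c) / c

/-! ### The lattice model -/

/-- The permutation operator on `ℂ² ⊗ ℂ²`. -/
def permOp : Matrix (Fin 2 × Fin 2) (Fin 2 × Fin 2) ℂ :=
  fun p q => if p = q.swap then 1 else 0

/-- The rational `R`-matrix `R(u, v) = ((u - v) / c) I + P` on `ℂ² ⊗ ℂ²`. -/
def R (c u v : ℂ) : Matrix (Fin 2 × Fin 2) (Fin 2 × Fin 2) ℂ :=
  ((u - v) / c) • (1 : Matrix (Fin 2 × Fin 2) (Fin 2 × Fin 2) ℂ) + permOp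

/-- `X_{a_i b_j}`: the operator `X` on `ℂ² ⊗ ℂ²` acting on the `i`-th row space and the `j`-th
column space, and as the identity on all the other spaces. -/
def onVertex {m n : ℕ} (i : Fin m) (j : Fin n) (X : Matrix (Fin 2 × Fin 2) (Fin 2 × Fin 2) ℂ) :
    Matrix (Conf m n) (Conf m n) ℂ :=
  fun p q =>
    if (∀ k, k ≠ i → p.1 k = q.1 k) ∧ (∀ l, l ≠ j → p.2 l = q.2 l) then
      X (p.1 i, p.2 j) (q.1 i, q.2 j)
    else 0

/-- `X_i`: the operator `X` on `ℂ²` acting on the `i`-th factor of `(ℂ²)^{⊗ k}`. -/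
def onSite {k : ℕ} (i : Fin k) (X : Matrix (Fin 2) (Fin 2) ℂ) :
    Matrix (Fin k → Fin 2) (Fin k → Fin 2) ℂ :=
  fun α β => if ∀ l, l ≠ i → α l = β l then X (α i) (β i) else 0

/-- `X_{a_i}` on the whole lattice space. -/
def onRow {m n : ℕ} (i : Fin m) (X : Matrix (Fin 2) (Fin 2) ℂ) :
    Matrix (Conf m n) (Conf m n) ℂ :=
  fun p q => if p.2 = q.2 then onSite i X p.1 q.1 else 0

/-- `X_{b_j}` on the whole lattice space. -/
def onCol {m n : ℕ} (j : Fin n) (X : Matrix (Fin 2) (Fin 2) ℂ) :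
    Matrix (Conf m n) (Conf m n) ℂ :=
  fun p q => if p.1 = q.1 then onSite j X p.2 q.2 else 0

/-- The matrix of the partition function: the product of the vertices `R_{a_i b_j}(u_i, v_j)`, with
`i` increasing from left to right and, for each `i`, with `j` increasing from left to right. -/
def latticeMatrix {m n : ℕ} (c : ℂ) (u : Fin m → ℂ) (v : Fin n → ℂ) :
    Matrix (Conf m n) (Conf m n) ℂ :=
  (List.ofFn fun i : Fin m =>
    (List.ofFn fun j : Fin n => onVertex i j (R c (u i) (v j))).prod).prod

/-- The twisted partition function
`Z_{mn}(u|v|B|Bh) = tr ((∏_j Bh_{b_j}) (∏_i B_{a_i}) Z(u|v))`, for arbitrary twists. -/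
def partitionFunction {m n : ℕ} (c : ℂ) (u : Fin m → ℂ) (v : Fin n → ℂ)
    (B Bh : Matrix (Fin 2) (Fin 2) ℂ) : ℂ :=
  Matrix.trace
    ((List.ofFn fun j : Fin n => (onCol j Bh : Matrix (Conf m n) (Conf m n) ℂ)).prod *
      (List.ofFn fun i : Fin m => (onRow i B : Matrix (Conf m n) (Conf m n) ℂ)).prod *
      latticeMatrix c u v)

/-! ### Transfer matrices and walls -/

/-- The single row monodromy matrix `T_a(x|v) = R_{a b_1}(x, v_1) ⋯ R_{a b_n}(x, v_n)`; the space
`V_a` is the only row space. -/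
def rowMonodromy {n : ℕ} (c x : ℂ) (v : Fin n → ℂ) : Matrix (Conf 1 n) (Conf 1 n) ℂ :=
  (List.ofFn fun j : Fin n => onVertex 0 j (R c x (v j))).prod

/-- The single column monodromy matrix `Th_b(y|u) = R_{a_1 b}(u_1, y) ⋯ R_{a_m b}(u_m, y)`; the
space `V_b` is the only column space. -/
def colMonodromy {m : ℕ} (c y : ℂ) (u : Fin m → ℂ) : Matrix (Conf m 1) (Conf m 1) ℂ :=
  (List.ofFn fun i : Fin m => onVertex i 0 (R c (u i) y)).prod

/-- The twisted row transfer matrix `B(x) = tr_a (B_a T_a(x|v))`. -/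
def rowTransfer {n : ℕ} (c : ℂ) (v : Fin n → ℂ) (B : Matrix (Fin 2) (Fin 2) ℂ) (x : ℂ) :
    Matrix (Fin n → Fin 2) (Fin n → Fin 2) ℂ :=
  fun γ δ => ∑ α : Fin 1 → Fin 2,
    ((onRow 0 B : Matrix (Conf 1 n) (Conf 1 n) ℂ) * rowMonodromy c x v) (α, γ) (α, δ)

/-- The twisted column transfer matrix `Bh(y) = tr_b (Bh_b Th_b(y|u))`. -/
def colTransfer {m : ℕ} (c : ℂ) (u : Fin m → ℂ) (Bh : Matrix (Fin 2) (Fin 2) ℂ) (y : ℂ) :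
    Matrix (Fin m → Fin 2) (Fin m → Fin 2) ℂ :=
  fun α β => ∑ γ : Fin 1 → Fin 2,
    ((onCol 0 Bh : Matrix (Conf m 1) (Conf m 1) ℂ) * colMonodromy c y u) (α, γ) (β, γ)

/-- A wall: the vector `x ⊗ ⋯ ⊗ x` of `(ℂ²)^{⊗ k}`. -/
def wall (k : ℕ) (x : Fin 2 → ℂ) : (Fin k → Fin 2) → ℂ := fun α => ∏ i, x (α i)

/-! ### The parameters and the modified Izergin determinant -/

/-- The Pauli matrix `σ_y`. -/
def sigmaY : Matrix (Fin 2) (Fin 2) ℂ := !![0, -Complex.I; Complex.I, 0]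

/-- `β = - tr (B σ_y Bhᵗ σ_y) / tr (B Bh)`. -/
def beta (B Bh : Matrix (Fin 2) (Fin 2) ℂ) : ℂ :=
  -Matrix.trace (B * sigmaY * Bhᵀ * sigmaY) / Matrix.trace (B * Bh)

/-- `χ = 1 - β`. -/
def chi (B Bh : Matrix (Fin 2) (Fin 2) ℂ) : ℂ := 1 - beta B Bh

/-- `λ₂(u) = ∏_{i,j} 1 / g(u_i, v_j)`. -/
def lambda2 {m n : ℕ} (c : ℂ) (u : Fin m → ℂ) (v : Fin n → ℂ) : ℂ :=
  ∏ i, ∏ j, 1 / g c (u i) (v j)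

/-- The modified Izergin determinant `K^{(z)}_{mn}(u|v)`, of size `n`. -/
def modifiedIzergin {m n : ℕ} (c z : ℂ) (u : Fin m → ℂ) (v : Fin n → ℂ) : ℂ :=
  Matrix.det (Matrix.of fun j k : Fin n =>
    -z * (if j = k then 1 else 0) +
      (∏ i, f c (u i) (v j)) * (∏ l ∈ Finset.univ.erase j, f c (v j) (v l)) / h c (v j) (v k))

/-- The determinant of size `m` that enters the second determinant representation. -/
def dualDet {m n : ℕ} (c z : ℂ) (u : Fin m → ℂ) (v : Fin n → ℂ) : ℂ :=
  Matrix.det (Matrix.of fun j k : Fin m =>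
    (if j = k then 1 else 0) * (∏ l, f c (u j) (v l)) -
      z * ((∏ i ∈ Finset.univ.erase j, f c (u j) (u i)) / h c (u j) (u k)))

end SixVertex

end

open scoped Matrix

noncomputable section

set_option linter.unusedSectionVars false

namespace SixVertex

/-! The twists have rank one, so the trace collapses to a matrix element of the lattice operator
between product vectors (`partitionFunction_eq_walls`). Contracting the row spaces one row at a time
turns it into a product of row transfer matrices. Flipping the lattice exchanges rows and columns
and replaces `c` by `-c`, which gives the column version and halves the work on the closed formulas.

The heart is the subset sum over the columns, `sitePF_eq_siteSum`, proved by induction on the rows.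
As functions of the parameter of one row, both sides are polynomials of degree at most `n`. Their
coefficients of degree `n` are `c⁻¹ ^ n` times the same quantities with that row deleted, so they
agree by induction. It remains to compare the sides at the `n` column parameters. The walls are
uniform, so by Yang–Baxter the columns may be permuted and the relevant one brought next to the row.
There the `R`-matrix is a pure permutation: it swaps two wall vectors, after which the rest of that
row and of that column act on the wall by scalars (`sitePF_freeze`). What is left is a smaller
lattice, and two contractions `w·e`, `s·ν` have become `s·e`, `w·ν`; their ratio is `χ`
(`chi_mul_trace`). The subset sum obeys the same recursion (`siteSum_cons_insert`). With no rows
left, the claim is a binomial identity for the weights `∏ f` (`sum_pow_mul_splitWeight`), which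
rests on Lagrange interpolation.

The determinants are these sums in disguise: expanding a diagonal matrix plus a Cauchy-type matrix
over its principal minors, each minor is an explicit Cauchy determinant (`det_add_cauchy`). -/

/-! ### The model on a finite set of sites -/

section Sites

variable {ι : Type*} [Fintype ι] [DecidableEq ι]

/-- The operator on `(ℂ²)^{⊗ ι}` that permutes the tensor factors. -/
def sitePerm (σ : Equiv.Perm ι) : Matrix (ι → Fin 2) (ι → Fin 2) ℂ :=
  fun α β => if β = α ∘ σ then 1 else 0

/-- The product vector with the factor `x k` at the site `k`. -/
def siteWall (x : ι → Fin 2 → ℂ) : (ι → Fin 2) → ℂ := fun α => ∏ k, x k (α k)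

theorem sitePerm_mul (σ τ : Equiv.Perm ι) : sitePerm σ * sitePerm τ = sitePerm (σ * τ) := by
  ext α β
  simp only [Matrix.mul_apply, sitePerm, ite_mul, one_mul, zero_mul, Finset.sum_ite_eq',
    Finset.mem_univ, if_true]
  rfl

theorem vecMul_sitePerm (x : ι → Fin 2 → ℂ) (σ : Equiv.Perm ι) :
    siteWall x ᵥ* sitePerm σ = siteWall (x ∘ σ) := by
  ext β
  have h : ∀ α : ι → Fin 2, (β = α ∘ σ) ↔ (β ∘ σ.symm = α) := by
    intro α
    constructor
    · rintro rfl
      ext k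
      simp
    · rintro rfl
      ext k
      simp
  simp only [Matrix.vecMul, dotProduct, sitePerm, siteWall, h, mul_ite, mul_one, mul_zero,
    Finset.sum_ite_eq, Finset.mem_univ, if_true, Function.comp_apply]
  exact Fintype.prod_equiv σ.symm _ _ (fun k => by simp)

theorem sitePerm_mulVec (y : ι → Fin 2 → ℂ) (σ : Equiv.Perm ι) :
    sitePerm σ *ᵥ siteWall y = siteWall (y ∘ σ.symm) := by
  ext α
  simp only [Matrix.mulVec, dotProduct, sitePerm, siteWall, ite_mul, one_mul, zero_mul,
    Finset.sum_ite_eq', Finset.mem_univ, if_true, Function.comp_apply]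
  exact Fintype.prod_equiv σ _ _ (fun k => by simp)

theorem siteWall_dotProduct (x y : ι → Fin 2 → ℂ) :
    siteWall x ⬝ᵥ siteWall y = ∏ k, x k ⬝ᵥ y k := by
  simp only [dotProduct, siteWall, ← Finset.prod_mul_distrib]
  rw [Finset.prod_univ_sum]
  simp

/-- The `R`-matrix acting on the sites `r` and `k`. -/
def siteR (c : ℂ) (z : ι → ℂ) (r k : ι) : Matrix (ι → Fin 2) (ι → Fin 2) ℂ :=
  ((z r - z k) / c) • (1 : Matrix (ι → Fin 2) (ι → Fin 2) ℂ) + sitePerm (Equiv.swap r k)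

/-- The product of the `R`-matrices along a row. -/
def siteRow (c : ℂ) (z : ι → ℂ) (cs : List ι) (r : ι) : Matrix (ι → Fin 2) (ι → Fin 2) ℂ :=
  (cs.map fun k => siteR c z r k).prod

/-- The product of the `R`-matrices over a lattice with given rows and columns. -/
def siteLattice (c : ℂ) (z : ι → ℂ) (rs cs : List ι) : Matrix (ι → Fin 2) (ι → Fin 2) ℂ :=
  (rs.map (siteRow c z cs)).prod

/-- The matrix element of the lattice operator between two product vectors. -/
def sitePF (c : ℂ) (z : ι → ℂ) (rs cs : List ι) (x y : ι → Fin 2 → ℂ) : ℂ :=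
  siteWall x ⬝ᵥ (siteLattice c z rs cs *ᵥ siteWall y)

/-! ### Yang–Baxter relation and symmetry of the lattice in its columns. -/

theorem commute_sitePerm {σ τ : Equiv.Perm ι} (h : Commute σ τ) :
    Commute (sitePerm σ) (sitePerm τ) := by
  rw [Commute, SemiconjBy, sitePerm_mul, sitePerm_mul, h.eq]

theorem commute_swap_swap {a b r k : ι} (h1 : a ≠ r) (h2 : a ≠ k) (h3 : b ≠ r) (h4 : b ≠ k) :
    Commute (Equiv.swap a b) (Equiv.swap r k) := by
  apply Equiv.Perm.Disjoint.commute
  intro l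
  by_cases ha : l = a
  · right; subst ha; exact Equiv.swap_apply_of_ne_of_ne h1 h2
  by_cases hb : l = b
  · right; subst hb; exact Equiv.swap_apply_of_ne_of_ne h3 h4
  · left; exact Equiv.swap_apply_of_ne_of_ne ha hb

theorem commute_smul_one_add {A : Type*} [Ring A] [Algebra ℂ A] {P Q : A} (h : Commute P Q)
    (a b : ℂ) : Commute (a • (1 : A) + P) (b • (1 : A) + Q) := by
  refine Commute.add_left ?_ (Commute.add_right ?_ h)
  · exact (Commute.one_left _).smul_left a
  · exact (Commute.one_right _).smul_right b

theorem commute_siteR (c : ℂ) (z : ι → ℂ) {a b r k : ι} (h1 : a ≠ r) (h2 : a ≠ k) (h3 : b ≠ r)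
    (h4 : b ≠ k) : Commute (siteR c z a b) (siteR c z r k) :=
  commute_smul_one_add (commute_sitePerm (commute_swap_swap h1 h2 h3 h4)) _ _

/-- The Yang–Baxter relation, in a form where the three braidings are elements of any algebra. -/
theorem yangBaxter_of_relations {A : Type*} [Ring A] [Algebra ℂ A] {P Q S : A}
    (h1 : P * Q = S * P) (h2 : Q * S = S * P) (h3 : Q * P = P * S) (h4 : S * Q = P * S)
    (x y : ℂ) :
    ((x - y) • (1 : A) + P) * ((x • (1 : A) + Q) * (y • (1 : A) + S)) =
      ((y • (1 : A) + S) * (x • (1 : A) + Q)) * ((x - y) • (1 : A) + P) := by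
  simp only [mul_add, add_mul, smul_mul_assoc, mul_smul_comm, one_mul, mul_one, h1, h2, h3, h4,
    ← mul_assoc]
  module

theorem siteR_yangBaxter (c : ℂ) (z : ι → ℂ) {r k l : ι} (hrk : r ≠ k) (hrl : r ≠ l)
    (hkl : k ≠ l) :
    SemiconjBy (((z l - z k) / c) • (1 : Matrix (ι → Fin 2) (ι → Fin 2) ℂ) +
      sitePerm (Equiv.swap k l)) (siteR c z r k * siteR c z r l)
      (siteR c z r l * siteR c z r k) := by
  have key := yangBaxter_of_relations (A := Matrix (ι → Fin 2) (ι → Fin 2) ℂ)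
    (P := sitePerm (Equiv.swap k l)) (Q := sitePerm (Equiv.swap r k))
    (S := sitePerm (Equiv.swap r l)) ?_ ?_ ?_ ?_ ((z r - z k) / c) ((z r - z l) / c)
  -- The row parameter cancels from the intertwiner, so one operator serves all rows at once.
  · have e : (z r - z k) / c - (z r - z l) / c = (z l - z k) / c := by ring
    rw [e] at key
    exact key
  all_goals
    rw [sitePerm_mul, sitePerm_mul]
    congr 1
    ext t
    simp only [Equiv.Perm.mul_apply, Equiv.swap_apply_def]
    grind

theorem siteRow_append (c : ℂ) (z : ι → ℂ) (l₁ l₂ : List ι) (r : ι) :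
    siteRow c z (l₁ ++ l₂) r = siteRow c z l₁ r * siteRow c z l₂ r := by
  simp [siteRow]

theorem siteRow_cons (c : ℂ) (z : ι → ℂ) (k : ι) (l : List ι) (r : ι) :
    siteRow c z (k :: l) r = siteR c z r k * siteRow c z l r := by
  simp [siteRow]

theorem siteLattice_cons (c : ℂ) (z : ι → ℂ) (r : ι) (rs cs : List ι) :
    siteLattice c z (r :: rs) cs = siteRow c z cs r * siteLattice c z rs cs := by
  simp [siteLattice]

theorem semiconjBy_list_prod {α M : Type*} [Monoid M] (a : M) (X Y : α → M) (l : List α)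
    (h : ∀ i ∈ l, SemiconjBy a (X i) (Y i)) :
    SemiconjBy a (l.map X).prod (l.map Y).prod := by
  induction l with
  | nil => simp
  | cons b l ih =>
    simp only [List.map_cons, List.prod_cons]
    exact (h b (by simp)).mul_right (ih fun i hi => h i (by simp [hi]))

theorem commute_siteRow {X : Matrix (ι → Fin 2) (ι → Fin 2) ℂ} (c : ℂ) (z : ι → ℂ)
    (cs : List ι) (r : ι) (h : ∀ k ∈ cs, Commute X (siteR c z r k)) :
    Commute X (siteRow c z cs r) :=
  semiconjBy_list_prod X _ _ cs h

theorem siteRow_swap (c : ℂ) (z : ι → ℂ) {r k l : ι} (l₁ l₂ : List ι)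
    (hnd : (l₁ ++ k :: l :: l₂).Nodup) (hr : r ∉ l₁ ++ k :: l :: l₂) :
    SemiconjBy (((z l - z k) / c) • (1 : Matrix (ι → Fin 2) (ι → Fin 2) ℂ) +
      sitePerm (Equiv.swap k l)) (siteRow c z (l₁ ++ k :: l :: l₂) r)
      (siteRow c z (l₁ ++ l :: k :: l₂) r) := by
  simp only [siteRow_append, siteRow_cons, ← mul_assoc (siteR c z r _) (siteR c z r _)]
  have hcomm : ∀ t ∈ l₁ ++ l₂, Commute (((z l - z k) / c) •
      (1 : Matrix (ι → Fin 2) (ι → Fin 2) ℂ) + sitePerm (Equiv.swap k l)) (siteR c z r t) := by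
    intro t ht
    apply commute_smul_one_add
    apply commute_sitePerm
    apply commute_swap_swap <;> grind
  refine SemiconjBy.mul_right (commute_siteRow c z _ _ fun t ht => hcomm t (by simp [ht]))
    (SemiconjBy.mul_right (siteR_yangBaxter c z ?_ ?_ ?_)
      (commute_siteRow c z _ _ fun t ht => hcomm t (by simp [ht]))) <;> grind

theorem continuous_siteLattice (c : ℂ) (rs cs : List ι) :
    Continuous fun z : ι → ℂ => siteLattice c z rs cs := by
  unfold siteLattice siteRow siteR
  refine continuous_list_prod _ fun r _ => continuous_list_prod _ fun k _ => ?_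
  fun_prop

theorem continuous_sitePF (c : ℂ) (rs cs : List ι) (x y : ι → Fin 2 → ℂ) :
    Continuous fun z : ι → ℂ => sitePF c z rs cs x y := by
  unfold sitePF
  exact continuous_const.dotProduct ((continuous_siteLattice c rs cs).matrix_mulVec
    continuous_const)

/-- The intertwiner of two adjacent columns passes through every row. Since equal wall vectors sit
at these columns on either side, it acts on both product vectors by one scalar, which cancels when
nonzero. The exceptional value of `z k` is reached by continuity. -/
theorem sitePF_swap_columns (c : ℂ) (hc : c ≠ 0) (z : ι → ℂ) {k l : ι} (rs l₁ l₂ : List ι)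
    (hnd : (l₁ ++ k :: l :: l₂).Nodup) (hr : ∀ r ∈ rs, r ∉ l₁ ++ k :: l :: l₂)
    (x y : ι → Fin 2 → ℂ) (hx : x k = x l) (hy : y k = y l) :
    sitePF c z rs (l₁ ++ k :: l :: l₂) x y = sitePF c z rs (l₁ ++ l :: k :: l₂) x y := by
  have hkl : k ≠ l := by grind
  have generic : ∀ z : ι → ℂ, z k ≠ z l + c →
      sitePF c z rs (l₁ ++ k :: l :: l₂) x y = sitePF c z rs (l₁ ++ l :: k :: l₂) x y := by
    intro z hz
    set X : Matrix (ι → Fin 2) (ι → Fin 2) ℂ := ((z l - z k) / c) • 1 +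
      sitePerm (Equiv.swap k l) with hX
    have hcomp : ∀ w : ι → Fin 2 → ℂ, w k = w l → w ∘ Equiv.swap k l = w := by
      intro w hw
      ext t : 1
      simp only [Function.comp_apply, Equiv.swap_apply_def]
      grind
    have hS : SemiconjBy X (siteLattice c z rs (l₁ ++ k :: l :: l₂))
        (siteLattice c z rs (l₁ ++ l :: k :: l₂)) :=
      semiconjBy_list_prod X _ _ rs fun r hrs => siteRow_swap c z l₁ l₂ hnd (hr r hrs)
    have hL : siteWall x ᵥ* X = ((z l - z k) / c + 1) • siteWall x := by
      rw [hX, Matrix.vecMul_add, vecMul_sitePerm, hcomp x hx, Matrix.vecMul_smul,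
        Matrix.vecMul_one, add_smul, one_smul]
    have hR : X *ᵥ siteWall y = ((z l - z k) / c + 1) • siteWall y := by
      rw [hX, Matrix.add_mulVec, sitePerm_mulVec, Equiv.symm_swap, hcomp y hy, Matrix.smul_mulVec,
        Matrix.one_mulVec, add_smul, one_smul]
    have h0 : (z l - z k) / c + 1 ≠ 0 := by
      intro h
      field_simp at h
      apply hz
      linear_combination -h
    have e := congrArg (fun M => siteWall x ⬝ᵥ (M *ᵥ siteWall y)) hS.eq
    simp only [← Matrix.mulVec_mulVec, hR] at e
    rw [Matrix.dotProduct_mulVec, hL, Matrix.mulVec_smul, dotProduct_smul, smul_dotProduct] at e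
    exact smul_right_injective ℂ h0 e
  -- The scalar vanishes only at `z k = z l + c`; the complement of this point is dense.
  have hcont : ∀ cs : List ι,
      Continuous fun t : ℂ => sitePF c (Function.update z k t) rs cs x y := fun cs =>
    (continuous_sitePF c rs cs x y).comp (continuous_const.update k continuous_id)
  have hEq := (hcont (l₁ ++ k :: l :: l₂)).ext_on (dense_compl_singleton (z l + c))
    (hcont (l₁ ++ l :: k :: l₂)) (fun t ht => generic _ (by
      rw [Function.update_self, Function.update_of_ne hkl.symm]
      exact ht))
  simpa using congrFun hEq (z k)

/-- Adjacent transpositions generate all permutations; the prefix `l₁` is what lets the induction on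
`List.Perm` pass under a common head. -/
theorem sitePF_perm_columns (c : ℂ) (hc : c ≠ 0) (z : ι → ℂ) (rs : List ι) (x y : ι → Fin 2 → ℂ)
    (a b : Fin 2 → ℂ) {cs cs' : List ι} (hp : cs.Perm cs') :
    ∀ l₁ : List ι, (l₁ ++ cs).Nodup → (∀ r ∈ rs, r ∉ l₁ ++ cs) → (∀ k ∈ cs, x k = a) →
      (∀ k ∈ cs, y k = b) → sitePF c z rs (l₁ ++ cs) x y = sitePF c z rs (l₁ ++ cs') x y := by
  induction hp with
  | nil => simp
  | cons k _ ih =>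
    intro l₁ h1 h2 h3 h4
    have := ih (l₁ ++ [k]) (by simpa using h1) (by simpa using h2)
      (fun t ht => h3 t (by simp [ht])) (fun t ht => h4 t (by simp [ht]))
    simpa using this
  | swap k l cs =>
    intro l₁ h1 h2 h3 h4
    exact sitePF_swap_columns c hc z rs l₁ cs h1 h2 x y (by rw [h3 l, h3 k] <;> simp)
      (by rw [h4 l, h4 k] <;> simp)
  | trans hp₁ _ ih₁ ih₂ =>
    intro l₁ h1 h2 h3 h4
    have hp' := hp₁.append_left l₁
    rw [ih₁ l₁ h1 h2 h3 h4]
    exact ih₂ l₁ (hp'.nodup_iff.1 h1) (fun r hr hm => h2 r hr (hp'.mem_iff.2 hm))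
      (fun k hk => h3 k (hp₁.mem_iff.2 hk)) (fun k hk => h4 k (hp₁.mem_iff.2 hk))

/-! ### Freezing of a corner -/

theorem vecMul_siteR_of_eq (c : ℂ) (z : ι → ℂ) {r k : ι} (x : ι → Fin 2 → ℂ) (h : x r = x k) :
    siteWall x ᵥ* siteR c z r k = ((z r - z k) / c + 1) • siteWall x := by
  have hcomp : x ∘ Equiv.swap r k = x := by
    ext t : 1
    simp only [Function.comp_apply, Equiv.swap_apply_def]
    grind
  rw [siteR, Matrix.vecMul_add, vecMul_sitePerm, hcomp, Matrix.vecMul_smul,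
    Matrix.vecMul_one, add_smul, one_smul]

theorem vecMul_list_prod {α κ : Type*} [Fintype κ] [DecidableEq κ] (l : List α)
    (X : α → Matrix κ κ ℂ) (a : α → ℂ) (ξ : κ → ℂ) (h : ∀ i ∈ l, ξ ᵥ* X i = a i • ξ) :
    ξ ᵥ* (l.map X).prod = (l.map a).prod • ξ := by
  induction l with
  | nil => simp
  | cons b l ih =>
    simp only [List.map_cons, List.prod_cons]
    rw [← Matrix.vecMul_vecMul, h b (by simp), Matrix.smul_vecMul,
      ih fun i hi => h i (by simp [hi]), smul_smul]

/-- In each row the first vertex acts on `ξ` by a scalar, and the rest of the row commutes with the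
vertices of column `k` in later rows. The covector therefore changes from row to row but stays an
eigenvector for what remains of the column; hence `ξ` is arbitrary in the induction. -/
theorem vecMul_siteLattice_cons_column (c : ℂ) (z : ι → ℂ) (k : ι) (cs : List ι) (hk : k ∉ cs) :
    ∀ (rs : List ι), rs.Nodup → (∀ r ∈ rs, r ∉ k :: cs) → ∀ (ξ : (ι → Fin 2) → ℂ),
      (∀ r ∈ rs, ξ ᵥ* siteR c z r k = ((z r - z k) / c + 1) • ξ) →
      ξ ᵥ* siteLattice c z rs (k :: cs) =
        (rs.map fun r => (z r - z k) / c + 1).prod • (ξ ᵥ* siteLattice c z rs cs) := by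
  intro rs
  induction rs with
  | nil => simp [siteLattice]
  | cons r rs ih =>
    intro hnd hdis ξ hξ
    rw [siteLattice_cons, siteLattice_cons, siteRow_cons, ← Matrix.vecMul_vecMul,
      ← Matrix.vecMul_vecMul, hξ r (by simp), Matrix.smul_vecMul, Matrix.smul_vecMul,
      ih (by grind) (by grind), smul_smul, Matrix.vecMul_vecMul]
    · simp
    · intro t ht
      have hcom : Commute (siteR c z t k) (siteRow c z cs r) :=
        commute_siteRow c z cs r fun l hl => commute_siteR c z (by grind) (by grind) (by grind)
          (by grind)
      rw [Matrix.vecMul_vecMul, ← hcom.eq, ← Matrix.vecMul_vecMul, hξ t (by simp [ht]),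
        Matrix.smul_vecMul]

/-- At `z r = z k` the corner vertex is the permutation. It puts the column wall vector on the row
`r` and the row wall vector on the column `k`, so each further vertex of that row or column meets
two equal vectors and is a scalar. -/
theorem sitePF_freeze (c : ℂ) (z : ι → ℂ) (r k : ι) (rs cs : List ι) (hrs : (r :: rs).Nodup)
    (hcs : (k :: cs).Nodup) (hdis : ∀ t ∈ r :: rs, t ∉ k :: cs) (hz : z r = z k)
    (x y : ι → Fin 2 → ℂ) (hxr : ∀ t ∈ rs, x t = x r) (hxk : ∀ t ∈ cs, x t = x k) :
    sitePF c z (r :: rs) (k :: cs) x y =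
      (cs.map fun l => (z r - z l) / c + 1).prod * (rs.map fun t => (z t - z k) / c + 1).prod *
        sitePF c z rs cs (x ∘ Equiv.swap r k) y := by
  have hrk : r ≠ k := fun h => hdis r (by simp) (by simp [h])
  have hsw : ∀ t, t ≠ r → t ≠ k → (x ∘ Equiv.swap r k) t = x t := by
    intro t h1 h2
    simp [Equiv.swap_apply_of_ne_of_ne h1 h2]
  have h1 : siteWall x ᵥ* siteR c z r k = siteWall (x ∘ Equiv.swap r k) := by
    rw [siteR, Matrix.vecMul_add, vecMul_sitePerm, hz]
    simp
  have h2 : siteWall (x ∘ Equiv.swap r k) ᵥ* siteRow c z cs r =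
      (cs.map fun l => (z r - z l) / c + 1).prod • siteWall (x ∘ Equiv.swap r k) := by
    refine vecMul_list_prod cs _ _ _ fun l hl => vecMul_siteR_of_eq c z _ ?_
    rw [hsw l (by grind) (by grind), hxk l hl]
    simp
  rw [sitePF, siteLattice_cons, siteRow_cons, Matrix.dotProduct_mulVec, ← Matrix.vecMul_vecMul,
    ← Matrix.vecMul_vecMul, h1, h2, Matrix.smul_vecMul,
    vecMul_siteLattice_cons_column c z k cs (by grind) rs (by grind) (by grind), smul_smul,
    smul_dotProduct, sitePF, Matrix.dotProduct_mulVec, smul_eq_mul]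
  intro t ht
  refine vecMul_siteR_of_eq c z _ ?_
  rw [hsw t (by grind) (by grind), hxr t ht]
  simp

end Sites

/-! ### Identities for the rational functions -/

section Rational

open Polynomial

variable {ι : Type*} [DecidableEq ι]

theorem f_neg (c a b : ℂ) : f (-c) a b = f c b a := by
  unfold f
  rw [← neg_sub b a, ← neg_add, neg_div_neg_eq]

/-- Both sides, times `c`, are the coefficient of degree `S.card - 1` of `∏ (X - z l + c) - ∏ (X - z
l)`: directly, and by Lagrange interpolation at the points `z i`, where the second product vanishes.
-/
theorem sum_prod_f_eq_card (c : ℂ) (hc : c ≠ 0) (z : ι → ℂ) (S : Finset ι)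
    (hz : Set.InjOn z S) :
    ∑ i ∈ S, ∏ l ∈ S.erase i, f c (z i) (z l) = S.card := by
  rcases S.eq_empty_or_nonempty with rfl | hS
  · simp
  have hpos : 0 < S.card := hS.card_pos
  have hmon : ∀ w : ι → ℂ, (∏ l ∈ S, (X - C (w l))).natDegree = S.card ∧
      (∏ l ∈ S, (X - C (w l))).coeff (S.card - 1) = -∑ l ∈ S, w l := by
    intro w
    have h1 : (∏ l ∈ S, (X - C (w l))).natDegree = S.card := by
      simp
    refine ⟨h1, ?_⟩
    rw [← prod_X_sub_C_nextCoeff, nextCoeff_of_natDegree_pos (by omega), h1]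
  have hP : ((∏ l ∈ S, (X - C (z l - c))) - ∏ l ∈ S, (X - C (z l))).degree <
      (S.card : WithBot ℕ) := by
    have h1 := monic_prod_of_monic S _ fun l _ => monic_X_sub_C (z l - c)
    have h2 := monic_prod_of_monic S _ fun l _ => monic_X_sub_C (z l)
    have h3 := degree_eq_natDegree h1.ne_zero
    have h4 := degree_eq_natDegree h2.ne_zero
    rw [(hmon _).1] at h3 h4
    rw [← h3]
    exact degree_sub_lt_left (h3.trans h4.symm) h1.ne_zero (by rw [h1.leadingCoeff, h2.leadingCoeff])
  have key := Lagrange.coeff_eq_sum hz hP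
  rw [coeff_sub, (hmon _).2, (hmon _).2, Finset.sum_sub_distrib, Finset.sum_const,
    nsmul_eq_mul] at key
  have hterm : ∀ i ∈ S, ((∏ l ∈ S, (X - C (z l - c))) - ∏ l ∈ S, (X - C (z l))).eval (z i) /
      ∏ j ∈ S.erase i, (z i - z j) = c * ∏ l ∈ S.erase i, f c (z i) (z l) := by
    intro i hi
    have h0 : ∏ l ∈ S, (z i - z l) = 0 := Finset.prod_eq_zero hi (sub_self _)
    rw [eval_sub, eval_prod, eval_prod]
    simp only [eval_sub, eval_X, eval_C, h0, sub_zero]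
    rw [← Finset.mul_prod_erase S _ hi, sub_sub_cancel, mul_div_assoc, ← Finset.prod_div_distrib]
    congr 1
    refine Finset.prod_congr rfl fun l _ => ?_
    rw [f]
    congr 1
    ring
  rw [Finset.sum_congr rfl hterm, ← Finset.mul_sum] at key
  apply mul_left_cancel₀ hc
  rw [← key]
  ring

/-! ### Sums of the subset weights over all subsets. -/

/-- The weight `∏_{j ∈ I} ∏_{k ∈ C \ I} f(z_j, z_k)` of a subset `I` of `C`. -/
def splitWeight (c : ℂ) (z : ι → ℂ) (C I : Finset ι) : ℂ :=
  ∏ j ∈ I, ∏ k ∈ C \ I, f c (z j) (z k)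

/-- Double counting of a subset with a marked element: moving the mark `i` out of `I` pairs `(I, i)`
with `(I.erase i, i)`. By `sum_prod_f_eq_card`, the factors `f` attached to the mark sum to a
cardinality on either side, and the paired terms are equal products. -/
theorem sum_card_mul_splitWeight (c : ℂ) (hc : c ≠ 0) (z : ι → ℂ) (C : Finset ι)
    (hz : Set.InjOn z C) (φ : ℕ → ℂ) :
    ∑ I ∈ C.powerset, φ I.card * I.card * splitWeight c z C I =
      ∑ J ∈ C.powerset, φ (J.card + 1) * ((C \ J).card : ℂ) * splitWeight c z C J := by
  have h1 : ∀ I ∈ C.powerset, φ I.card * I.card * splitWeight c z C I =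
      ∑ i ∈ I, φ I.card * (∏ l ∈ I.erase i, f c (z l) (z i)) * splitWeight c z C I := by
    intro I hI
    have hI' : I ⊆ C := Finset.mem_powerset.1 hI
    rw [← Finset.sum_mul, ← Finset.mul_sum]
    -- The factors inside `I` have the marked element as second argument; `-c` in place of `c`
    -- reverses the arguments.
    simp only [← f_neg c]
    rw [sum_prod_f_eq_card (-c) (neg_ne_zero.2 hc) z I (hz.mono (by exact_mod_cast hI'))]
  have h2 : ∀ J ∈ C.powerset, φ (J.card + 1) * ((C \ J).card : ℂ) * splitWeight c z C J =
      ∑ i ∈ C \ J, φ (J.card + 1) * (∏ l ∈ (C \ J).erase i, f c (z i) (z l)) *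
        splitWeight c z C J := by
    intro J hJ
    rw [← Finset.sum_mul, ← Finset.mul_sum,
      sum_prod_f_eq_card c hc z (C \ J) (hz.mono (by simp))]
  rw [Finset.sum_congr rfl h1, Finset.sum_congr rfl h2, Finset.sum_sigma', Finset.sum_sigma']
  refine Finset.sum_bij' (fun a _ => ⟨a.1.erase a.2, a.2⟩) (fun a _ => ⟨insert a.2 a.1, a.2⟩)
    ?_ ?_ ?_ ?_ ?_
  · rintro ⟨I, i⟩ h
    simp only [Finset.mem_sigma, Finset.mem_powerset, Finset.mem_sdiff] at h ⊢
    exact ⟨(Finset.erase_subset _ _).trans h.1, h.1 h.2, Finset.notMem_erase _ _⟩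
  · rintro ⟨I, i⟩ h
    simp only [Finset.mem_sigma, Finset.mem_powerset, Finset.mem_sdiff] at h ⊢
    exact ⟨Finset.insert_subset h.2.1 h.1, Finset.mem_insert_self _ _⟩
  · rintro ⟨I, i⟩ h
    simp only [Finset.mem_sigma, Finset.mem_powerset] at h
    simp [Finset.insert_erase h.2]
  · rintro ⟨I, i⟩ h
    simp only [Finset.mem_sigma, Finset.mem_powerset, Finset.mem_sdiff] at h
    simp [Finset.erase_insert h.2.2]
  · rintro ⟨I, i⟩ h
    simp only [Finset.mem_sigma, Finset.mem_powerset] at h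
    obtain ⟨hI, hi⟩ := h
    have e3 : i ∉ C \ I := fun h => (Finset.mem_sdiff.1 h).2 hi
    have e2 : C \ I.erase i = insert i (C \ I) := Finset.sdiff_erase (hI hi)
    have e1 : (C \ I.erase i).erase i = C \ I := by rw [e2, Finset.erase_insert e3]
    dsimp only
    rw [Finset.card_erase_add_one hi, e1, splitWeight, splitWeight, e2,
      ← Finset.mul_prod_erase I _ hi]
    simp only [Finset.prod_insert e3, Finset.prod_mul_distrib]
    ring

theorem sum_splitWeight_powersetCard (c : ℂ) (hc : c ≠ 0) (z : ι → ℂ) (C : Finset ι)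
    (hz : Set.InjOn z C) (r : ℕ) :
    ∑ I ∈ C.powersetCard r, splitWeight c z C I = (C.card.choose r : ℂ) := by
  induction r with
  | zero => simp [splitWeight]
  | succ r ih =>
    -- The indicator of one cardinality gives `(r + 1) S_{r+1} = (N - r) S_r` for the layer sums,
    -- which is the recursion of the binomial coefficients.
    have key := sum_card_mul_splitWeight c hc z C hz (fun k => if k = r + 1 then 1 else 0)
    simp only [add_left_inj, ite_mul, one_mul, zero_mul, ← Finset.sum_filter,
      ← Finset.powersetCard_eq_filter] at key
    have h1 : ∀ I ∈ C.powersetCard (r + 1), (I.card : ℂ) * splitWeight c z C I =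
        ((r + 1 : ℕ) : ℂ) * splitWeight c z C I := fun I hI => by
      rw [(Finset.mem_powersetCard.1 hI).2]
    have h2 : ∀ I ∈ C.powersetCard r, ((C \ I).card : ℂ) * splitWeight c z C I =
        ((C.card - r : ℕ) : ℂ) * splitWeight c z C I := fun I hI => by
      rw [Finset.card_sdiff_of_subset (Finset.mem_powersetCard.1 hI).1,
        (Finset.mem_powersetCard.1 hI).2]
    rw [Finset.sum_congr rfl h1, Finset.sum_congr rfl h2, ← Finset.mul_sum, ← Finset.mul_sum, ih,
      ← Nat.cast_mul, mul_comm (C.card - r), ← Nat.choose_succ_right_eq, Nat.cast_mul,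
      mul_comm] at key
    exact mul_right_cancel₀ (Nat.cast_ne_zero.2 (Nat.succ_ne_zero r)) key

theorem sum_pow_mul_splitWeight (c : ℂ) (hc : c ≠ 0) (z : ι → ℂ) (C : Finset ι)
    (hz : Set.InjOn z C) (a : ℂ) :
    ∑ I ∈ C.powerset, a ^ (C \ I).card * splitWeight c z C I = (1 + a) ^ C.card := by
  rw [Finset.sum_powerset, add_pow]
  refine Finset.sum_congr rfl fun r _ => ?_
  rw [one_pow, one_mul, ← sum_splitWeight_powersetCard c hc z C hz r, Finset.mul_sum]
  refine Finset.sum_congr rfl fun I hI => ?_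
  rw [Finset.card_sdiff_of_subset (Finset.mem_powersetCard.1 hI).1,
    (Finset.mem_powersetCard.1 hI).2]

/-! ### The subset sum and its recursion. -/

/-- The contribution of a row to the summand of a subset `I` of the set `C` of columns. -/
def rowWeight (c : ℂ) (z : ι → ℂ) (C I : Finset ι) (a : ℂ) : ℂ :=
  (∏ j ∈ I, ((a - z j) / c + 1)) * ∏ j ∈ C \ I, (a - z j) / c

/-- The sum over the subsets of the set `C` of columns. -/
def siteSum (c b : ℂ) (z : ι → ℂ) (rs : List ι) (C : Finset ι) : ℂ :=
  ∑ I ∈ C.powerset, b ^ (C \ I).card * (rs.map fun r => rowWeight c z C I (z r)).prod *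
    splitWeight c z C I

theorem siteSum_nil (c : ℂ) (hc : c ≠ 0) (b : ℂ) (z : ι → ℂ) (C : Finset ι)
    (hz : Set.InjOn z C) : siteSum c b z [] C = (1 + b) ^ C.card := by
  rw [← sum_pow_mul_splitWeight c hc z C hz b]
  simp [siteSum]

/-- At `z r = z k` a subset omitting `k` has a zero factor from row `r`. For a subset containing
`k`, the factors `f (z k) (z l)` with `l` outside it turn `(z r - z l) / c` into `(z r - z l) / c +
1`, so row `r` contributes the same product for every subset. -/
theorem siteSum_cons_insert (c : ℂ) (hc : c ≠ 0) (b : ℂ) (z : ι → ℂ) (r : ι) (rs : List ι) (k : ι)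
    (D : Finset ι) (hk : k ∉ D) (hz : ∀ l ∈ D, z k ≠ z l) (hr : z r = z k) :
    siteSum c b z (r :: rs) (insert k D) =
      (∏ l ∈ D, ((z r - z l) / c + 1)) * (rs.map fun t => (z t - z k) / c + 1).prod *
        siteSum c b z rs D := by
  rw [siteSum, Finset.sum_powerset_insert hk]
  have h1 : ∀ I ∈ D.powerset, b ^ (insert k D \ I).card *
      ((r :: rs).map fun r => rowWeight c z (insert k D) I (z r)).prod *
      splitWeight c z (insert k D) I = 0 := by
    intro I hI
    have hkI : k ∈ insert k D \ I := by grind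
    have : rowWeight c z (insert k D) I (z r) = 0 := by
      rw [rowWeight, Finset.prod_eq_zero hkI, mul_zero]
      rw [hr, sub_self, zero_div]
    simp [this]
  rw [Finset.sum_eq_zero h1, zero_add, siteSum, Finset.mul_sum]
  refine Finset.sum_congr rfl fun I hI => ?_
  have hI : I ⊆ D := Finset.mem_powerset.1 hI
  have hkI : k ∉ I := fun h => hk (hI h)
  have e1 : insert k D \ insert k I = D \ I := by grind
  have hrow : ∀ t, rowWeight c z (insert k D) (insert k I) t =
      ((t - z k) / c + 1) * rowWeight c z D I t := by
    intro t
    rw [rowWeight, rowWeight, e1, Finset.prod_insert hkI, mul_assoc]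
  have hsplit : splitWeight c z (insert k D) (insert k I) =
      (∏ l ∈ D \ I, f c (z k) (z l)) * splitWeight c z D I := by
    rw [splitWeight, splitWeight, e1, Finset.prod_insert hkI]
  have hD : rowWeight c z D I (z r) * ∏ l ∈ D \ I, f c (z k) (z l) =
      ∏ l ∈ D, ((z r - z l) / c + 1) := by
    rw [rowWeight, mul_assoc, ← Finset.prod_mul_distrib, ← Finset.prod_sdiff hI, mul_comm]
    congr 1
    refine Finset.prod_congr rfl fun l hl => ?_
    have h0 : z k - z l ≠ 0 := sub_ne_zero.2 (hz l (Finset.mem_sdiff.1 hl).1)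
    rw [hr, f]
    field_simp
  simp only [hrow, hsplit, e1, List.map_cons, List.prod_cons, List.prod_map_mul]
  rw [← hD, hr, sub_self, zero_div, zero_add, one_mul]
  ring


/-! ### Polynomial functions with a prescribed leading coefficient -/

/-- `F` is a polynomial function of degree at most `n` whose coefficient of degree `n` is `a`. -/
def HasTopCoeff (n : ℕ) (a : ℂ) (F : ℂ → ℂ) : Prop :=
  ∃ p : ℂ[X], p.natDegree ≤ n ∧ p.coeff n = a ∧ ∀ t, F t = p.eval t

theorem HasTopCoeff.const (a : ℂ) : HasTopCoeff 0 a fun _ => a :=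
  ⟨C a, by simp, by simp, by simp⟩

theorem HasTopCoeff.linear (a b : ℂ) : HasTopCoeff 1 a fun t => a * t + b :=
  ⟨C a * X + C b, natDegree_linear_le, by simp, by simp⟩

theorem HasTopCoeff.mul {n m : ℕ} {a b : ℂ} {F G : ℂ → ℂ} (hF : HasTopCoeff n a F)
    (hG : HasTopCoeff m b G) : HasTopCoeff (n + m) (a * b) fun t => F t * G t := by
  obtain ⟨p, h1, h2, h3⟩ := hF
  obtain ⟨q, h4, h5, h6⟩ := hG
  exact ⟨p * q, natDegree_mul_le_of_le h1 h4, by rw [coeff_mul_add_eq_of_natDegree_le h1 h4, h2, h5],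
    fun t => by simp only [h3, h6, eval_mul]⟩

theorem HasTopCoeff.const_mul {n : ℕ} {a : ℂ} {F : ℂ → ℂ} (b : ℂ) (hF : HasTopCoeff n a F) :
    HasTopCoeff n (b * a) fun t => b * F t := by
  simpa using (HasTopCoeff.const b).mul hF

theorem HasTopCoeff.sum {n : ℕ} {α : Type*} (s : Finset α) {a : α → ℂ} {F : α → ℂ → ℂ}
    (h : ∀ i ∈ s, HasTopCoeff n (a i) (F i)) :
    HasTopCoeff n (∑ i ∈ s, a i) fun t => ∑ i ∈ s, F i t := by
  classical
  induction s using Finset.induction_on with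
  | empty => exact ⟨0, by simp, by simp, by simp⟩
  | insert i s hi ih =>
    obtain ⟨p, h1, h2, h3⟩ := h i (by simp)
    obtain ⟨q, h4, h5, h6⟩ := ih fun j hj => h j (by simp [hj])
    refine ⟨p + q, natDegree_add_le_of_degree_le h1 h4, by simp [Finset.sum_insert hi, h2, h5],
      fun t => ?_⟩
    simp only [Finset.sum_insert hi, eval_add, h3, ← h6]

theorem HasTopCoeff.prod {α : Type*} (s : Finset α) {a : α → ℂ} {F : α → ℂ → ℂ}
    (h : ∀ i ∈ s, HasTopCoeff 1 (a i) (F i)) :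
    HasTopCoeff s.card (∏ i ∈ s, a i) fun t => ∏ i ∈ s, F i t := by
  classical
  induction s using Finset.induction_on with
  | empty => simpa using HasTopCoeff.const 1
  | insert i s hi ih =>
    have := (h i (by simp)).mul (ih fun j hj => h j (by simp [hj]))
    simpa only [Finset.prod_insert hi, Finset.card_insert_of_notMem hi, add_comm] using this

/-- Equal top coefficients bring the degree of the difference below the number of nodes. -/
theorem HasTopCoeff.eq_of_nodes {S : Finset ι} {z : ι → ℂ} (hz : Set.InjOn z S) {a : ℂ}
    {F G : ℂ → ℂ} (hF : HasTopCoeff S.card a F) (hG : HasTopCoeff S.card a G)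
    (h : ∀ k ∈ S, F (z k) = G (z k)) : F = G := by
  obtain ⟨p, h1, h2, h3⟩ := hF
  obtain ⟨q, h4, h5, h6⟩ := hG
  have hlt : (p - q).degree < S.card := by
    rw [degree_lt_iff_coeff_zero]
    intro d hd
    rcases hd.eq_or_lt with rfl | hd
    · rw [coeff_sub, h2, h5, sub_self]
    · rw [coeff_sub, coeff_eq_zero_of_natDegree_lt (h1.trans_lt hd),
        coeff_eq_zero_of_natDegree_lt (h4.trans_lt hd), sub_self]
  have := eq_of_degree_sub_lt_of_eval_index_eq S hz hlt fun k hk => by rw [← h3, ← h6, h k hk]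
  ext t
  rw [h3, h6, this]

/-- Every column gives one linear factor of slope `c⁻¹`, whether or not it lies in `I`; the top
coefficient is therefore common to all subsets and factors out of the sum. -/
theorem hasTopCoeff_rowWeight (c : ℂ) (z : ι → ℂ) {C I : Finset ι} (hI : I ⊆ C) :
    HasTopCoeff C.card (c⁻¹ ^ C.card) (rowWeight c z C I) := by
  have h1 : HasTopCoeff I.card (∏ j ∈ I, c⁻¹) fun a => ∏ j ∈ I, ((a - z j) / c + 1) :=
    HasTopCoeff.prod I fun j _ => by
      convert HasTopCoeff.linear c⁻¹ (-z j / c + 1) using 2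
      ring
  have h2 : HasTopCoeff (C \ I).card (∏ j ∈ C \ I, c⁻¹) fun a => ∏ j ∈ C \ I, (a - z j) / c :=
    HasTopCoeff.prod (C \ I) fun j _ => by
      convert HasTopCoeff.linear c⁻¹ (-z j / c) using 2
      ring
  have h3 := h1.mul h2
  have e : I.card + (C \ I).card = C.card := by
    rw [add_comm, Finset.card_sdiff_add_card_eq_card hI]
  rw [Finset.prod_const, Finset.prod_const, ← pow_add, e] at h3
  exact h3

theorem hasTopCoeff_siteSum_cons (c b : ℂ) (z : ι → ℂ) (r : ι) (rs : List ι) (C : Finset ι)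
    (hrs : r ∉ rs) (hrC : r ∉ C) :
    HasTopCoeff C.card (c⁻¹ ^ C.card * siteSum c b z rs C)
      fun t => siteSum c b (Function.update z r t) (r :: rs) C := by
  have e : ∀ t, siteSum c b (Function.update z r t) (r :: rs) C = ∑ I ∈ C.powerset,
      (b ^ (C \ I).card * (rs.map fun r => rowWeight c z C I (z r)).prod * splitWeight c z C I) *
        rowWeight c z C I t := by
    intro t
    refine Finset.sum_congr rfl fun I hI => ?_
    have hI : I ⊆ C := Finset.mem_powerset.1 hI
    have hup : ∀ k ∈ C, Function.update z r t k = z k := fun k hk =>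
      Function.update_of_ne (ne_of_mem_of_not_mem hk hrC) _ _
    have hrow : ∀ a, rowWeight c (Function.update z r t) C I a = rowWeight c z C I a := fun a => by
      unfold rowWeight
      congr 1
      · exact Finset.prod_congr rfl fun j hj => by rw [hup j (hI hj)]
      · exact Finset.prod_congr rfl fun j hj => by rw [hup j (Finset.mem_sdiff.1 hj).1]
    have hsplit : splitWeight c (Function.update z r t) C I = splitWeight c z C I :=
      Finset.prod_congr rfl fun j hj => Finset.prod_congr rfl fun k hk => by
        rw [hup j (hI hj), hup k (Finset.mem_sdiff.1 hk).1]
    have hmap : (rs.map fun r' => rowWeight c z C I (Function.update z r t r')) =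
        rs.map fun r' => rowWeight c z C I (z r') :=
      List.map_congr_left fun r' hr' => by
        rw [Function.update_of_ne (ne_of_mem_of_not_mem hr' hrs)]
    simp only [hrow, hsplit, List.map_cons, List.prod_cons, Function.update_self, hmap]
    ring
  simp only [e]
  rw [siteSum, Finset.mul_sum]
  refine HasTopCoeff.sum _ fun I hI => ?_
  rw [mul_comm (c⁻¹ ^ _)]
  exact (hasTopCoeff_rowWeight c z (Finset.mem_powerset.1 hI)).const_mul _

end Rational

/-! ### Evaluation of the model on a finite set of sites -/

section Evaluation

variable {ι : Type*} [Fintype ι] [DecidableEq ι]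

theorem siteRow_congr (c : ℂ) {z z' : ι → ℂ} {r : ι} (cs : List ι) (hr : z r = z' r)
    (hcs : ∀ k ∈ cs, z k = z' k) : siteRow c z cs r = siteRow c z' cs r := by
  unfold siteRow
  congr 1
  exact List.map_congr_left fun k hk => by rw [siteR, siteR, hr, hcs k hk]

theorem siteLattice_congr (c : ℂ) {z z' : ι → ℂ} (rs cs : List ι) (hrs : ∀ r ∈ rs, z r = z' r)
    (hcs : ∀ k ∈ cs, z k = z' k) : siteLattice c z rs cs = siteLattice c z' rs cs := by
  unfold siteLattice
  congr 1
  exact List.map_congr_left fun r hr => siteRow_congr c cs (hrs r hr) hcs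

/-- In each factor the permutation is constant in the row parameter, so only multiples of the
identity reach the top degree: at infinity the row disappears from the lattice. -/
theorem hasTopCoeff_siteRow (c : ℂ) (z : ι → ℂ) (r : ι) (cs : List ι) (hr : r ∉ cs)
    (α β : ι → Fin 2) :
    HasTopCoeff cs.length ((c⁻¹ ^ cs.length • (1 : Matrix (ι → Fin 2) (ι → Fin 2) ℂ)) α β)
      fun t => siteRow c (Function.update z r t) cs r α β := by
  induction cs generalizing α β with
  | nil =>
    simpa [siteRow] using HasTopCoeff.const ((1 : Matrix (ι → Fin 2) (ι → Fin 2) ℂ) α β)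
  | cons k cs ih =>
    have hk : k ≠ r := fun h => hr (by simp [h])
    have h1 : ∀ γ, HasTopCoeff 1 ((c⁻¹ • (1 : Matrix (ι → Fin 2) (ι → Fin 2) ℂ)) α γ)
        fun t => siteR c (Function.update z r t) r k α γ := by
      intro γ
      convert HasTopCoeff.linear ((c⁻¹ • (1 : Matrix (ι → Fin 2) (ι → Fin 2) ℂ)) α γ)
        (-(z k / c) * (1 : Matrix (ι → Fin 2) (ι → Fin 2) ℂ) α γ +
          sitePerm (Equiv.swap r k) α γ) using 2
      simp only [siteR, Function.update_self, Function.update_of_ne hk, Matrix.add_apply,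
        Matrix.smul_apply, smul_eq_mul]
      ring
    have h2 := HasTopCoeff.sum Finset.univ fun γ _ =>
      (h1 γ).mul (ih (fun h => hr (by simp [h])) γ β)
    simp only [siteRow_cons, Matrix.mul_apply]
    convert h2 using 1
    · rw [List.length_cons, add_comm]
    · rw [← Matrix.mul_apply, smul_mul_smul_comm, one_mul, List.length_cons, pow_succ']

theorem hasTopCoeff_sitePF_cons (c : ℂ) (z : ι → ℂ) (r : ι) (rs cs : List ι) (hrs : r ∉ rs)
    (hcs : r ∉ cs) (x y : ι → Fin 2 → ℂ) :
    HasTopCoeff cs.length (c⁻¹ ^ cs.length * sitePF c z rs cs x y)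
      fun t => sitePF c (Function.update z r t) (r :: rs) cs x y := by
  have hL : ∀ t, siteLattice c (Function.update z r t) rs cs = siteLattice c z rs cs := fun t =>
    siteLattice_congr c rs cs (fun k hk => Function.update_of_ne (ne_of_mem_of_not_mem hk hrs) _ _)
      (fun k hk => Function.update_of_ne (ne_of_mem_of_not_mem hk hcs) _ _)
  simp only [sitePF, siteLattice_cons, ← Matrix.mulVec_mulVec, hL]
  generalize siteLattice c z rs cs *ᵥ siteWall y = η
  have e : c⁻¹ ^ cs.length * (siteWall x ⬝ᵥ η) =
      siteWall x ⬝ᵥ ((c⁻¹ ^ cs.length • (1 : Matrix (ι → Fin 2) (ι → Fin 2) ℂ)) *ᵥ η) := by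
    rw [Matrix.smul_mulVec, Matrix.one_mulVec, dotProduct_smul, smul_eq_mul]
  rw [e]
  simp only [dotProduct, Matrix.mulVec]
  refine HasTopCoeff.sum _ fun α _ => HasTopCoeff.const_mul _ (HasTopCoeff.sum _ fun β _ => ?_)
  simp only [mul_comm _ (η β)]
  exact (hasTopCoeff_siteRow c z r cs hcs α β).const_mul _

/-- Cross-multiplied, since individual contractions may vanish. -/
theorem prod_comp_swap_mul {r k : ι} (hrk : r ≠ k) (x y : ι → Fin 2 → ℂ) :
    (∏ l, (x ∘ Equiv.swap r k) l ⬝ᵥ y l) * ((x r ⬝ᵥ y r) * (x k ⬝ᵥ y k)) =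
      (∏ l, x l ⬝ᵥ y l) * ((x k ⬝ᵥ y r) * (x r ⬝ᵥ y k)) := by
  have hk : k ∈ (Finset.univ : Finset ι).erase r := by simp [hrk.symm]
  rw [← Finset.mul_prod_erase Finset.univ _ (Finset.mem_univ r),
    ← Finset.mul_prod_erase (Finset.univ.erase r) _ hk,
    ← Finset.mul_prod_erase Finset.univ (fun l => x l ⬝ᵥ y l) (Finset.mem_univ r),
    ← Finset.mul_prod_erase (Finset.univ.erase r) (fun l => x l ⬝ᵥ y l) hk]
  have : ∏ l ∈ (Finset.univ.erase r).erase k, (x ∘ Equiv.swap r k) l ⬝ᵥ y l =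
      ∏ l ∈ (Finset.univ.erase r).erase k, x l ⬝ᵥ y l :=
    Finset.prod_congr rfl fun l hl => by
      simp only [Finset.mem_erase] at hl
      rw [Function.comp_apply, Equiv.swap_apply_of_ne_of_ne hl.2.1 hl.1]
  rw [this]
  simp only [Function.comp_apply, Equiv.swap_apply_left, Equiv.swap_apply_right]
  ring

/-- Freezing leaves two sites on which the lattice no longer acts, with interchanged wall vectors.
The statement therefore allows idle sites with arbitrary vectors, and the prefactor runs over all
sites. -/
theorem sitePF_eq_siteSum (c : ℂ) (hc : c ≠ 0) (w e s ν : Fin 2 → ℂ) (χ : ℂ) (hp : w ⬝ᵥ e ≠ 0)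
    (hq : s ⬝ᵥ ν ≠ 0) (hχ0 : χ ≠ 0)
    (hχ : χ * ((s ⬝ᵥ e) * (w ⬝ᵥ ν)) = (w ⬝ᵥ e) * (s ⬝ᵥ ν)) (rs : List ι) :
    rs.Nodup → ∀ (cs : List ι) (z : ι → ℂ) (x y : ι → Fin 2 → ℂ), cs.Nodup →
      (∀ r ∈ rs, r ∉ cs) → (∀ r ∈ rs, x r = w ∧ y r = e) → (∀ k ∈ cs, x k = s ∧ y k = ν) →
      (∀ k ∈ cs, ∀ l ∈ cs, z k = z l → k = l) →
      sitePF c z rs cs x y =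
        (∏ l, x l ⬝ᵥ y l) / χ ^ cs.length * siteSum c (χ - 1) z rs cs.toFinset := by
  induction rs with
  | nil =>
    intro _ cs z x y hcs _ _ _ hz
    rw [siteSum_nil c hc _ _ _ (fun k hk l hl => hz k (by simpa using hk) l (by simpa using hl)),
      List.toFinset_card_of_nodup hcs, add_sub_cancel, div_mul_cancel₀ _ (pow_ne_zero _ hχ0)]
    simp [sitePF, siteLattice, siteWall_dotProduct]
  | cons r rs ih =>
    intro hrs cs z x y hcs hdis hr hk hz
    obtain ⟨hrrs, hrs'⟩ := List.nodup_cons.1 hrs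
    have hrcs : r ∉ cs := hdis r (by simp)
    have hlen : cs.toFinset.card = cs.length := List.toFinset_card_of_nodup hcs
    have hF := hasTopCoeff_sitePF_cons c z r rs cs hrrs hrcs x y
    have hG := (hasTopCoeff_siteSum_cons c (χ - 1) z r rs cs.toFinset hrrs
      (by simpa using hrcs)).const_mul ((∏ l, x l ⬝ᵥ y l) / χ ^ cs.length)
    rw [ih hrs' cs z x y hcs (fun t ht => hdis t (by simp [ht])) (fun t ht => hr t (by simp [ht]))
      hk hz, ← hlen, mul_left_comm] at hF
    rw [← hlen] at hG
    have hEq := HasTopCoeff.eq_of_nodes (z := z) (S := cs.toFinset)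
      (fun k hk l hl => hz k (by simpa using hk) l (by simpa using hl)) hF hG ?_
    · have := congrFun hEq (z r)
      simpa [hlen] using this
    intro k hkcs
    rw [List.mem_toFinset] at hkcs
    have hrk : r ≠ k := fun h => hrcs (h ▸ hkcs)
    have hperm := List.perm_cons_erase hkcs
    have hnd : (k :: cs.erase k).Nodup := hperm.nodup_iff.1 hcs
    have hmem : ∀ t, t ∈ cs.erase k → t ∈ cs := fun t ht => List.mem_of_mem_erase ht
    have hkne : ∀ t, t ∈ cs.erase k → t ≠ k := by
      rintro t ht rfl
      exact (List.nodup_cons.1 hnd).1 ht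
    set z' := Function.update z r (z k) with hz'
    have hz'cs : ∀ t ∈ cs, z' t = z t := fun t ht =>
      Function.update_of_ne (ne_of_mem_of_not_mem ht hrcs) _ _
    have hz'r : z' r = z' k := by
      rw [hz'cs k hkcs, hz', Function.update_self]
    -- At the node `z k`, column `k` is brought to the corner before freezing.
    have h1 : sitePF c z' (r :: rs) cs x y = sitePF c z' (r :: rs) (k :: cs.erase k) x y := by
      simpa using sitePF_perm_columns c hc z' (r :: rs) x y s ν hperm [] (by simpa using hcs)
        (by simpa using hdis) (fun t ht => (hk t ht).1) (fun t ht => (hk t ht).2)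
    have hsw : ∀ t, t ≠ r → t ≠ k → (x ∘ Equiv.swap r k) t = x t := by
      intro t h1 h2
      simp [Equiv.swap_apply_of_ne_of_ne h1 h2]
    have h2 := sitePF_freeze c z' r k rs (cs.erase k) hrs hnd
      (fun t ht h => hdis t ht (hperm.mem_iff.2 h)) hz'r x y
      (fun t ht => by rw [(hr t (by simp [ht])).1, (hr r (by simp)).1])
      (fun t ht => by rw [(hk t (hmem t ht)).1, (hk k hkcs).1])
    have h3 := ih hrs' (cs.erase k) z' (x ∘ Equiv.swap r k) y (List.nodup_cons.1 hnd).2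
      (fun t ht h => hdis t (by simp [ht]) (hmem t h))
      (fun t ht => by
        rw [hsw t (ne_of_mem_of_not_mem ht hrrs)
          (ne_of_mem_of_not_mem hkcs (hdis t (by simp [ht]))).symm]
        exact hr t (by simp [ht]))
      (fun t ht => by
        rw [hsw t (ne_of_mem_of_not_mem (hmem t ht) hrcs) (hkne t ht)]
        exact hk t (hmem t ht))
      (fun a ha b hb h => hz a (hmem a ha) b (hmem b hb)
        (by rwa [hz'cs a (hmem a ha), hz'cs b (hmem b hb)] at h))
    have hins : cs.toFinset = insert k (cs.erase k).toFinset := by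
      rw [← List.toFinset_cons]
      exact List.toFinset_eq_of_perm _ _ hperm
    have h4 := siteSum_cons_insert c hc (χ - 1) z' r rs k (cs.erase k).toFinset
      (by simpa using (List.nodup_cons.1 hnd).1)
      (fun l hl h => by
        rw [List.mem_toFinset] at hl
        rw [hz'cs k hkcs, hz'cs l (hmem l hl)] at h
        exact hkne l hl (hz k hkcs l (hmem l hl) h).symm) hz'r
    have h5 := prod_comp_swap_mul hrk x y
    rw [(hr r (by simp)).1, (hr r (by simp)).2, (hk k hkcs).1, (hk k hkcs).2, ← hχ] at h5
    have hT : (s ⬝ᵥ e) * (w ⬝ᵥ ν) ≠ 0 := fun h => mul_ne_zero hp hq (by rw [← hχ, h, mul_zero])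
    -- Freezing divides the product of contractions by `χ`; this matches the loss of one column in
    -- `χ ^ cs.length`.
    have h6 : (∏ l, (x ∘ Equiv.swap r k) l ⬝ᵥ y l) * χ = ∏ l, x l ⬝ᵥ y l := by
      apply mul_right_cancel₀ hT
      rw [← h5]
      ring
    have h7 : cs.length = (cs.erase k).length + 1 := by
      simpa using hperm.length_eq
    rw [h1, h2, h3, hlen, h7, hins, h4, ← h6,
      List.prod_toFinset _ (List.nodup_cons.1 hnd).2]
    field_simp
    ring

end Evaluation

/-! ### Determinants -/

section Determinants

variable {α : Type*} [Fintype α] [DecidableEq α]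

/-- Multilinearity in the rows: `I` is the set of rows taken from `A`, and the remaining diagonal
rows reduce the determinant to a principal minor. -/
theorem det_diagonal_add (d : α → ℂ) (A : Matrix α α ℂ) :
    (Matrix.diagonal d + A).det =
      ∑ I : Finset α, (∏ i ∈ Iᶜ, d i) * (A.submatrix (↑) (↑) : Matrix I I ℂ).det := by
  have key : (A + Matrix.diagonal d).det =
      ∑ I : Finset α, (Matrix.of (I.piecewise A (Matrix.diagonal d))).det :=
    AlternatingMap.map_add_univ Matrix.detRowAlternating A (Matrix.diagonal d)
  rw [add_comm, key]
  refine Finset.sum_congr rfl fun I _ => ?_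
  have h : Matrix.of (I.piecewise A (Matrix.diagonal d)) =
      Matrix.of fun i j => (if i ∈ I then 1 else d i) *
        (Matrix.of (I.piecewise A.row (1 : Matrix α α ℂ).row)) i j := by
    ext i j
    by_cases hi : i ∈ I <;>
      simp [Finset.piecewise, hi, Matrix.diagonal_apply, Matrix.one_apply]
  rw [h, Matrix.det_mul_column, Matrix.det_piecewise_one_eq_submatrix_det]
  congr 1
  rw [← Finset.prod_subset (Finset.subset_univ Iᶜ)]
  · exact Finset.prod_congr rfl fun i hi => if_neg (Finset.mem_compl.1 hi)
  · intro i _ hi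
    simp at hi
    simp [hi]

/-- Induction by Schur complement on the new diagonal entry, which is `c / c = 1`. The complement is
the smaller matrix of the same type with rescaled rows and columns, and the scalings supply the new
factors of the product. -/
theorem det_cauchy_shift (c : ℂ) (hc : c ≠ 0) (v : α → ℂ) (h : ∀ j k, v j - v k + c ≠ 0) :
    (Matrix.of fun j k => c / (v j - v k + c)).det =
      ∏ j, ∏ k, if k = j then 1 else (v j - v k) / (v j - v k + c) := by
  revert v
  refine Fintype.induction_empty_option (P := fun α _ => ∀ [DecidableEq α] (v : α → ℂ),
    (∀ j k, v j - v k + c ≠ 0) → (Matrix.of fun j k => c / (v j - v k + c)).det =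
      ∏ j, ∏ k, if k = j then 1 else (v j - v k) / (v j - v k + c)) ?_ ?_ ?_ α
  · intro α β _ φ ih _ v h
    classical
    let _ := Fintype.ofEquiv β φ.symm
    have := ih (v ∘ φ) fun j k => h _ _
    rw [← Matrix.det_submatrix_equiv_self φ]
    refine Eq.trans ?_ (this.trans ?_)
    · rfl
    · refine Fintype.prod_equiv φ _ _ fun j => Fintype.prod_equiv φ _ _ fun k => ?_
      simp
  · intro _ v _
    simp
  · intro α _ ih _ v h
    classical
    rw [← Matrix.det_submatrix_equiv_self (Equiv.optionEquivSumPUnit.{0} α).symm]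
    have hblock : (Matrix.of fun j k => c / (v j - v k + c)).submatrix
        (Equiv.optionEquivSumPUnit.{0} α).symm (Equiv.optionEquivSumPUnit.{0} α).symm =
        Matrix.fromBlocks (Matrix.of fun j k : α => c / (v (some j) - v (some k) + c))
          (Matrix.of fun j (_ : Unit) => c / (v (some j) - v none + c))
          (Matrix.of fun (_ : Unit) k => c / (v none - v (some k) + c)) 1 := by
      ext (j | j) (k | k) <;> simp [hc]
    rw [hblock, Matrix.det_fromBlocks_one₂₂]
    have hS : (Matrix.of fun j k : α => c / (v (some j) - v (some k) + c)) -
          (Matrix.of fun j (_ : Unit) => c / (v (some j) - v none + c)) *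
          (Matrix.of fun (_ : Unit) k => c / (v none - v (some k) + c)) =
        Matrix.of fun j k => (v (some j) - v none) / (v (some j) - v none + c) *
          (Matrix.of fun j k => (v none - v (some k)) / (v none - v (some k) + c) *
            (Matrix.of fun j k : α => c / (v (some j) - v (some k) + c)) j k) j k := by
      ext j k
      have h1 := h (some j) (some k)
      have h2 := h (some j) none
      have h3 := h none (some k)
      simp only [Matrix.sub_apply, Matrix.of_apply, Matrix.mul_apply, Finset.univ_unique,
        Finset.sum_const, Finset.card_singleton, one_smul]
      field_simp
      ring
    rw [hS, Matrix.det_mul_column, Matrix.det_mul_row, ih (fun j => v (some j)) fun j k => h _ _]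
    simp only [Fintype.prod_option, reduceCtorEq, if_false, if_true, Option.some_inj, one_mul,
      Finset.prod_mul_distrib]

/-- A determinant of Cauchy type, expanded over the subsets of the index set. -/
theorem det_add_cauchy (c : ℂ) (hc : c ≠ 0) (v : α → ℂ) (hv : Function.Injective v)
    (h0 : ∀ j k, v j - v k + c ≠ 0) (d E : α → ℂ) :
    (Matrix.of fun j k => (if j = k then d j else 0) +
      E j * (∏ l ∈ Finset.univ.erase j, f c (v j) (v l)) / h c (v j) (v k)).det =
      ∑ I : Finset α, (∏ i ∈ Iᶜ, d i) * (∏ j ∈ I, E j) *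
        ∏ j ∈ I, ∏ k ∈ Iᶜ, f c (v j) (v k) := by
  set D : α → ℂ := fun j => E j * ∏ l ∈ Finset.univ.erase j, f c (v j) (v l) with hD
  have hM : (Matrix.of fun j k => (if j = k then d j else 0) + D j / h c (v j) (v k)) =
      Matrix.diagonal d + Matrix.of fun j k => D j * (c / (v j - v k + c)) := by
    ext j k
    simp only [Matrix.of_apply, Matrix.add_apply, Matrix.diagonal_apply, h, div_div_eq_mul_div,
      mul_div_assoc]
  rw [hM, det_diagonal_add]
  refine Finset.sum_congr rfl fun I _ => ?_
  have hsub : ((Matrix.of fun j k => D j * (c / (v j - v k + c))).submatrix (↑) (↑) :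
      Matrix I I ℂ) = Matrix.of fun j k : I => D j *
        (Matrix.of fun j k : I => c / (v j - v k + c)) j k := rfl
  rw [hsub, Matrix.det_mul_column, det_cauchy_shift c hc (fun j : I => v j) fun j k => h0 j k,
    mul_assoc]
  congr 1
  rw [← Finset.prod_mul_distrib, ← Finset.prod_mul_distrib, ← Finset.prod_coe_sort I]
  refine Finset.prod_congr rfl fun j _ => ?_
  have h1 : (∏ k : I, if k = j then (1 : ℂ) else (v j - v k) / (v j - v k + c)) =
      ∏ k ∈ I.erase j, (v j - v k) / (v j - v k + c) := by
    rw [Finset.prod_coe_sort_eq_attach, ← Finset.mul_prod_erase I.attach _ (Finset.mem_attach _ j),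
      if_pos rfl, one_mul, ← Finset.prod_attach (I.erase j)]
    refine Finset.prod_bij' (fun k hk => ⟨k, by
        simp only [Finset.mem_erase, Finset.mem_attach, and_true] at hk
        simp only [Finset.mem_erase, k.2, and_true]
        exact fun e => hk (Subtype.ext e)⟩)
      (fun k _ => ⟨k, Finset.mem_of_mem_erase k.2⟩) ?_ ?_ ?_ ?_ ?_
    · simp
    · intro k _
      have := Finset.ne_of_mem_erase k.2
      simpa [Subtype.ext_iff] using this
    · simp
    · simp
    · intro k hk
      simp only [Finset.mem_erase] at hk
      rw [if_neg hk.1]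
  have h2 : Finset.univ.erase (j : α) = I.erase j ∪ Iᶜ := by
    ext k
    have := j.2
    by_cases hk : k ∈ I
    · simp [hk]
    · have : k ≠ j := fun e => hk (e ▸ j.2)
      simp [hk, this]
  have h3 : Disjoint (I.erase (j : α)) Iᶜ :=
    Finset.disjoint_left.2 fun k hk hk' => Finset.mem_compl.1 hk' (Finset.mem_of_mem_erase hk)
  -- Inside `I` the factors `f` are inverse to those of the Cauchy minor; only the factors between
  -- `I` and its complement survive.
  have h4 : (∏ k ∈ I.erase j, f c (v j) (v k)) *
      ∏ k ∈ I.erase j, (v j - v k) / (v j - v k + c) = 1 := by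
    rw [← Finset.prod_mul_distrib]
    refine Finset.prod_eq_one fun k hk => ?_
    have h5 : v j - v k ≠ 0 := sub_ne_zero.2 fun e => Finset.ne_of_mem_erase hk (hv e).symm
    have h6 := h0 j k
    rw [f]
    field_simp
  rw [h1, hD]
  dsimp only
  rw [h2, Finset.prod_union h3]
  linear_combination E j * (∏ k ∈ Iᶜ, f c (v j) (v k)) * h4

end Determinants

/-! ### The model with four walls -/

section Walls

open scoped Kronecker

/-- The vector attached to two walls. -/
def walls (m n : ℕ) (x y : Fin 2 → ℂ) : Conf m n → ℂ := fun p => wall m x p.1 * wall n y p.2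

theorem prod_onSite_apply {k : ℕ} (l : List (Fin k)) (hl : l.Nodup) (X : Matrix (Fin 2) (Fin 2) ℂ)
    (α β : Fin k → Fin 2) :
    (l.map fun i => (onSite i X : Matrix (Fin k → Fin 2) (Fin k → Fin 2) ℂ)).prod α β =
      if ∀ i, i ∉ l → α i = β i then (l.map fun i => X (α i) (β i)).prod else 0 := by
  induction l generalizing α with
  | nil => simp [Matrix.one_apply, funext_iff]
  | cons i l ih =>
    obtain ⟨hi, hl⟩ := List.nodup_cons.1 hl
    -- Only one intermediate configuration contributes: the first operator changes only site `i`,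
    -- and the later ones leave that site alone, so it must already carry `β i`.
    rw [List.map_cons, List.prod_cons, Matrix.mul_apply,
      Finset.sum_eq_single (Function.update α i (β i))]
    · rw [ih hl, onSite, if_pos]
      · have h1 : (l.map fun j => X (Function.update α i (β i) j) (β j)) =
            l.map fun j => X (α j) (β j) :=
          List.map_congr_left fun j hj => by
            rw [Function.update_of_ne (ne_of_mem_of_not_mem hj hi)]
        rw [h1, Function.update_self, mul_ite, mul_zero, List.map_cons, List.prod_cons]
        congr 1
        refine propext ⟨fun h j hj => ?_, fun h j hj => ?_⟩
        · have := h j fun h => hj (by simp [h])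
          rwa [Function.update_of_ne (fun e => hj (by simp [e]))] at this
        · by_cases e : j = i
          · subst e
            simp
          · rw [Function.update_of_ne e]
            exact h j (by simp [e, hj])
      · intro j hj
        rw [Function.update_of_ne hj]
    · intro γ _ hγ
      rw [ih hl, onSite]
      split_ifs with h1 h2
      · exfalso
        apply hγ
        ext j : 1
        by_cases e : j = i
        · subst e
          simpa using h2 j hi
        · rw [Function.update_of_ne e]
          exact (h1 j e).symm
      · simp
      · simp
      · simp
    · simp

theorem onRow_eq_kronecker {m n : ℕ} (i : Fin m) (X : Matrix (Fin 2) (Fin 2) ℂ) :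
    (onRow i X : Matrix (Conf m n) (Conf m n) ℂ) = onSite i X ⊗ₖ 1 := by
  ext p q
  simp [onRow, Matrix.kroneckerMap_apply, Matrix.one_apply]

theorem onCol_eq_kronecker {m n : ℕ} (j : Fin n) (X : Matrix (Fin 2) (Fin 2) ℂ) :
    (onCol j X : Matrix (Conf m n) (Conf m n) ℂ) = 1 ⊗ₖ onSite j X := by
  ext p q
  simp [onCol, Matrix.kroneckerMap_apply, Matrix.one_apply]

theorem prod_onRow {m n : ℕ} (l : List (Fin m)) (X : Matrix (Fin 2) (Fin 2) ℂ) :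
    (l.map fun i => (onRow i X : Matrix (Conf m n) (Conf m n) ℂ)).prod =
      (l.map fun i => onSite i X).prod ⊗ₖ 1 := by
  induction l with
  | nil => simp
  | cons i l ih =>
    rw [List.map_cons, List.prod_cons, ih, onRow_eq_kronecker, ← Matrix.mul_kronecker_mul]
    simp

theorem prod_onCol {m n : ℕ} (l : List (Fin n)) (X : Matrix (Fin 2) (Fin 2) ℂ) :
    (l.map fun j => (onCol j X : Matrix (Conf m n) (Conf m n) ℂ)).prod =
      1 ⊗ₖ (l.map fun j => onSite j X).prod := by
  induction l with
  | nil => simp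
  | cons i l ih =>
    rw [List.map_cons, List.prod_cons, ih, onCol_eq_kronecker, ← Matrix.mul_kronecker_mul]
    simp

theorem prod_onSite_vecMulVec {k : ℕ} (x y : Fin 2 → ℂ) :
    ((List.finRange k).map fun i => onSite i (Matrix.vecMulVec x y)).prod =
      Matrix.vecMulVec (wall k x) (wall k y) := by
  ext α β
  rw [prod_onSite_apply _ (List.nodup_finRange k), if_pos (by simp), ← List.ofFn_eq_map,
    List.prod_ofFn]
  simp [Matrix.vecMulVec_apply, wall, Finset.prod_mul_distrib]

/-- The product of rank-one twists over all sites is again of rank one, and the trace against it is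
a matrix element. -/
theorem partitionFunction_eq_walls {m n : ℕ} (c : ℂ) (u : Fin m → ℂ) (v : Fin n → ℂ)
    (w e s ν : Fin 2 → ℂ) :
    partitionFunction c u v (Matrix.vecMulVec e w) (Matrix.vecMulVec ν s) =
      walls m n w s ⬝ᵥ (latticeMatrix c u v *ᵥ walls m n e ν) := by
  rw [partitionFunction, List.ofFn_eq_map, List.ofFn_eq_map, prod_onRow, prod_onCol,
    ← Matrix.mul_kronecker_mul, one_mul, mul_one, prod_onSite_vecMulVec, prod_onSite_vecMulVec]
  have h : Matrix.vecMulVec (wall m e) (wall m w) ⊗ₖ Matrix.vecMulVec (wall n ν) (wall n s) =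
      Matrix.vecMulVec (walls m n e ν) (walls m n w s) := by
    ext p q
    simp only [Matrix.kroneckerMap_apply, Matrix.vecMulVec_apply, walls]
    ring
  rw [h, Matrix.vecMulVec_mul, Matrix.trace_vecMulVec, Matrix.dotProduct_mulVec, dotProduct_comm]

/-! ### Splitting off the first row -/

/-- The first row of the lattice, as a lattice with a single row. -/
def headEquiv (m n : ℕ) : Conf (m + 1) n ≃ Conf 1 n × (Fin m → Fin 2) where
  toFun p := ((fun _ => p.1 0, p.2), Fin.tail p.1)
  invFun q := (Fin.cons (q.1.1 0) q.2, q.1.2)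
  left_inv p := by simp
  right_inv q := by
    ext i
    · simp [Subsingleton.elim i 0]
    · simp
    · simp

/-- The lattice without its first row. -/
def tailEquiv (m n : ℕ) : Conf (m + 1) n ≃ Fin 2 × Conf m n where
  toFun p := (p.1 0, Fin.tail p.1, p.2)
  invFun q := (Fin.cons q.1 q.2.1, q.2.2)
  left_inv p := by simp
  right_inv q := by simp

/-- Operators on the first row, as operators on the lattice. -/
def embedHead (m n : ℕ) : Matrix (Conf 1 n) (Conf 1 n) ℂ →*
    Matrix (Conf (m + 1) n) (Conf (m + 1) n) ℂ where
  toFun A := (A ⊗ₖ (1 : Matrix (Fin m → Fin 2) (Fin m → Fin 2) ℂ)).submatrix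
    (headEquiv m n) (headEquiv m n)
  map_one' := by rw [Matrix.one_kronecker_one, Matrix.submatrix_one_equiv]
  map_mul' A A' := by
    rw [Matrix.submatrix_mul_equiv, ← Matrix.mul_kronecker_mul, one_mul]

/-- Operators on the lattice without its first row, as operators on the lattice. -/
def embedTail (m n : ℕ) : Matrix (Conf m n) (Conf m n) ℂ →*
    Matrix (Conf (m + 1) n) (Conf (m + 1) n) ℂ where
  toFun M := ((1 : Matrix (Fin 2) (Fin 2) ℂ) ⊗ₖ M).submatrix (tailEquiv m n) (tailEquiv m n)
  map_one' := by rw [Matrix.one_kronecker_one, Matrix.submatrix_one_equiv]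
  map_mul' A A' := by
    rw [Matrix.submatrix_mul_equiv, ← Matrix.mul_kronecker_mul, one_mul]

theorem embedHead_apply {m n : ℕ} (A : Matrix (Conf 1 n) (Conf 1 n) ℂ) (p q : Conf (m + 1) n) :
    embedHead m n A p q = if Fin.tail p.1 = Fin.tail q.1 then
      A (fun _ => p.1 0, p.2) (fun _ => q.1 0, q.2) else 0 := by
  simp [embedHead, headEquiv, Matrix.kroneckerMap_apply, Matrix.one_apply]

theorem embedTail_apply {m n : ℕ} (M : Matrix (Conf m n) (Conf m n) ℂ) (p q : Conf (m + 1) n) :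
    embedTail m n M p q = if p.1 0 = q.1 0 then
      M (Fin.tail p.1, p.2) (Fin.tail q.1, q.2) else 0 := by
  simp [embedTail, tailEquiv, Matrix.kroneckerMap_apply, Matrix.one_apply]

theorem onVertex_zero_eq {m n : ℕ} (j : Fin n) (X : Matrix (Fin 2 × Fin 2) (Fin 2 × Fin 2) ℂ) :
    (onVertex 0 j X : Matrix (Conf (m + 1) n) (Conf (m + 1) n) ℂ) =
      embedHead m n (onVertex 0 j X) := by
  ext p q
  rw [embedHead_apply, onVertex, onVertex, ← ite_and]
  congr 1
  simp [Fin.forall_fin_succ, funext_iff, Fin.tail]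

theorem onVertex_succ_eq {m n : ℕ} (i : Fin m) (j : Fin n)
    (X : Matrix (Fin 2 × Fin 2) (Fin 2 × Fin 2) ℂ) :
    (onVertex i.succ j X : Matrix (Conf (m + 1) n) (Conf (m + 1) n) ℂ) =
      embedTail m n (onVertex i j X) := by
  ext p q
  rw [embedTail_apply, onVertex, onVertex, ← ite_and]
  congr 1
  simp [Fin.forall_fin_succ, Fin.tail, (Fin.succ_ne_zero i).symm, and_assoc]

theorem latticeMatrix_succ {m n : ℕ} (c : ℂ) (u : Fin (m + 1) → ℂ) (v : Fin n → ℂ) :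
    latticeMatrix c u v = embedHead m n (rowMonodromy c (u 0) v) *
      embedTail m n (latticeMatrix c (Fin.tail u) v) := by
  rw [latticeMatrix, List.ofFn_succ, List.prod_cons, rowMonodromy, latticeMatrix, map_list_prod,
    map_list_prod, List.map_ofFn, List.map_ofFn]
  simp only [Function.comp_def, map_list_prod, List.map_ofFn, ← onVertex_zero_eq,
    ← onVertex_succ_eq, Fin.tail]

/-- The operator on the column spaces left by the walls at the two ends of every row. -/
def contractRows {m n : ℕ} (w e : Fin 2 → ℂ) (M : Matrix (Conf m n) (Conf m n) ℂ) :
    Matrix (Fin n → Fin 2) (Fin n → Fin 2) ℂ :=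
  fun γ δ => ∑ α, ∑ β, wall m w α * wall m e β * M (α, γ) (β, δ)

theorem walls_dotProduct_mulVec {m n : ℕ} (w e s ν : Fin 2 → ℂ)
    (M : Matrix (Conf m n) (Conf m n) ℂ) :
    walls m n w s ⬝ᵥ (M *ᵥ walls m n e ν) = wall n s ⬝ᵥ (contractRows w e M *ᵥ wall n ν) := by
  simp only [walls, dotProduct, Matrix.mulVec, contractRows, Fintype.sum_prod_type,
    Finset.mul_sum, Finset.sum_mul]
  rw [Finset.sum_comm]
  refine Finset.sum_congr rfl fun γ _ => ?_
  conv_rhs => rw [Finset.sum_comm]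
  refine Finset.sum_congr rfl fun α _ => ?_
  conv_rhs => rw [Finset.sum_comm]
  refine Finset.sum_congr rfl fun β _ => Finset.sum_congr rfl fun δ _ => ?_
  ring

theorem sum_fin_one (F : (Fin 1 → Fin 2) → ℂ) : ∑ α, F α = ∑ a, F fun _ => a :=
  ((Equiv.funUnique (Fin 1) (Fin 2)).symm.sum_comp F).symm

theorem sum_fin_cons {m : ℕ} (F : (Fin (m + 1) → Fin 2) → ℂ) :
    ∑ α, F α = ∑ a, ∑ α, F (Fin.cons a α) := by
  rw [← Fintype.sum_prod_type']
  exact ((Fin.consEquiv fun _ => Fin 2).sum_comp F).symm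

theorem embedHead_mul_embedTail_apply {m n : ℕ} (A : Matrix (Conf 1 n) (Conf 1 n) ℂ)
    (M : Matrix (Conf m n) (Conf m n) ℂ) (a b : Fin 2) (α β : Fin m → Fin 2)
    (γ δ : Fin n → Fin 2) :
    (embedHead m n A * embedTail m n M) (Fin.cons a α, γ) (Fin.cons b β, δ) =
      ∑ κ, A (fun _ => a, γ) (fun _ => b, κ) * M (α, κ) (β, δ) := by
  -- The tail fixes the first row space and the head fixes the others, so the row part of the
  -- intermediate state is forced to be `b` followed by `α`.
  rw [Matrix.mul_apply, Fintype.sum_prod_type, sum_fin_cons, Finset.sum_eq_single b,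
    Finset.sum_eq_single α]
  · simp [embedHead_apply, embedTail_apply]
  · intro t _ ht
    simp [embedHead_apply, ht.symm]
  · simp
  · intro t _ ht
    simp [embedTail_apply, ht]
  · simp

theorem contractRows_mul {m n : ℕ} (w e : Fin 2 → ℂ) (A : Matrix (Conf 1 n) (Conf 1 n) ℂ)
    (M : Matrix (Conf m n) (Conf m n) ℂ) :
    contractRows w e (embedHead m n A * embedTail m n M) =
      contractRows w e A * contractRows w e M := by
  ext γ δ
  have hw : ∀ (x : Fin 2 → ℂ) a (α : Fin m → Fin 2),
      wall (m + 1) x (Fin.cons a α) = x a * wall m x α := fun x a α => by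
    simp [wall, Fin.prod_univ_succ]
  have h1 : ∀ (x : Fin 2 → ℂ) a, wall 1 x (fun _ => a) = x a := fun x a => by simp [wall]
  have hA : ∀ κ, contractRows w e A γ κ =
      ∑ a, ∑ b, w a * e b * A (fun _ => a, γ) (fun _ => b, κ) := fun κ => by
    simp only [contractRows, sum_fin_one, h1]
  rw [Matrix.mul_apply]
  simp only [hA]
  simp only [contractRows, sum_fin_cons, embedHead_mul_embedTail_apply, hw, Finset.sum_mul,
    Finset.mul_sum]
  conv_lhs => rw [Finset.sum_comm]
  conv_rhs => rw [Finset.sum_comm]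
  refine Finset.sum_congr rfl fun α _ => ?_
  conv_rhs =>
    enter [2, κ]
    rw [Finset.sum_comm]
  conv_rhs => rw [Finset.sum_comm]
  refine Finset.sum_congr rfl fun a _ => ?_
  conv_rhs =>
    enter [2, κ]
    rw [Finset.sum_comm]
  conv_rhs => rw [Finset.sum_comm]
  refine Finset.sum_congr rfl fun b _ => ?_
  conv_rhs => rw [Finset.sum_comm]
  refine Finset.sum_congr rfl fun β _ => Finset.sum_congr rfl fun κ _ => ?_
  ring

theorem onSite_zero_apply (X : Matrix (Fin 2) (Fin 2) ℂ) (a b : Fin 2) :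
    onSite (k := 1) 0 X (fun _ => a) (fun _ => b) = X a b := by
  simp [onSite, Fin.forall_fin_one]

theorem contractRows_rowMonodromy {n : ℕ} (c x : ℂ) (v : Fin n → ℂ) (w e : Fin 2 → ℂ) :
    contractRows w e (rowMonodromy c x v) = rowTransfer c v (Matrix.vecMulVec e w) x := by
  ext γ δ
  simp only [contractRows, rowTransfer, Matrix.mul_apply, Fintype.sum_prod_type, sum_fin_one,
    onRow, ite_mul, zero_mul, Finset.sum_ite_eq, Finset.mem_univ, if_true, onSite_zero_apply,
    Matrix.vecMulVec_apply]
  rw [Finset.sum_comm]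
  refine Finset.sum_congr rfl fun a _ => Finset.sum_congr rfl fun b _ => ?_
  simp [wall, mul_comm]

theorem contractRows_latticeMatrix {m n : ℕ} (c : ℂ) (u : Fin m → ℂ) (v : Fin n → ℂ)
    (w e : Fin 2 → ℂ) :
    contractRows w e (latticeMatrix c u v) =
      (List.ofFn fun i => rowTransfer c v (Matrix.vecMulVec e w) (u i)).prod := by
  induction m with
  | zero =>
    ext γ δ
    rw [contractRows, Fintype.sum_unique, Fintype.sum_unique]
    simp [latticeMatrix, wall, Matrix.one_apply]
  | succ m ih =>
    rw [latticeMatrix_succ, contractRows_mul, contractRows_rowMonodromy, ih, List.ofFn_succ,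
      List.prod_cons]
    rfl

end Walls

/-! ### Exchange of rows and columns -/

section Exchange

theorem list_prod_map_mul {M β : Type*} [Monoid M] (a b : β → M) (l : List β) (hl : l.Nodup)
    (h : ∀ j ∈ l, ∀ k ∈ l, j ≠ k → Commute (a j) (b k)) :
    (l.map fun j => a j * b j).prod = (l.map a).prod * (l.map b).prod := by
  induction l with
  | nil => simp
  | cons k l ih =>
    obtain ⟨hk, hl⟩ := List.nodup_cons.1 hl
    have hcomm : Commute (l.map a).prod (b k) := by
      refine Commute.list_prod_left _ _ fun x hx => ?_
      obtain ⟨j, hj, rfl⟩ := List.mem_map.1 hx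
      exact h j (by simp [hj]) k (by simp) (ne_of_mem_of_not_mem hj hk)
    simp only [List.map_cons, List.prod_cons]
    rw [ih hl fun j hj k hk => h j (by simp [hj]) k (by simp [hk])]
    simp only [mul_assoc]
    rw [← mul_assoc (b k), ← hcomm.eq, mul_assoc]

/-- Row-by-row and column-by-column orderings agree on the order of any two vertices sharing a line;
all other pairs commute. -/
theorem list_prod_prod_comm {M α β : Type*} [Monoid M] (X : α → β → M) (l : List α)
    (l' : List β) (hl : l.Nodup) (hl' : l'.Nodup)
    (h : ∀ i ∈ l, ∀ i' ∈ l, ∀ j ∈ l', ∀ j' ∈ l', i ≠ i' → j ≠ j' → Commute (X i j) (X i' j')) :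
    (l.map fun i => (l'.map fun j => X i j).prod).prod =
      (l'.map fun j => (l.map fun i => X i j).prod).prod := by
  induction l with
  | nil => simp
  | cons i l ih =>
    obtain ⟨hi, hl⟩ := List.nodup_cons.1 hl
    simp only [List.map_cons, List.prod_cons]
    rw [ih hl fun a ha b hb => h a (by simp [ha]) b (by simp [hb]), list_prod_map_mul _ _ _ hl']
    intro j hj k hk hjk
    refine Commute.list_prod_right _ _ fun x hx => ?_
    obtain ⟨i', hi', rfl⟩ := List.mem_map.1 hx
    exact h i (by simp) i' (by simp [hi']) j hj k hk (ne_of_mem_of_not_mem hi' hi).symm hjk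

/-- Configurations of the lattice, as configurations of the set of all its lines. -/
def lineEquiv (m n : ℕ) : (Fin m ⊕ Fin n → Fin 2) ≃ Conf m n :=
  Equiv.sumArrowEquivProdArrow (Fin m) (Fin n) (Fin 2)

theorem lineEquiv_symm_inl {m n : ℕ} (p : Conf m n) (i : Fin m) :
    (lineEquiv m n).symm p (Sum.inl i) = p.1 i := rfl

theorem lineEquiv_symm_inr {m n : ℕ} (p : Conf m n) (j : Fin n) :
    (lineEquiv m n).symm p (Sum.inr j) = p.2 j := rfl

/-- With rows and columns as one index set, the permutation at a vertex is the transposition of two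
tensor factors. -/
theorem onVertex_R_eq {m n : ℕ} (c : ℂ) (u : Fin m → ℂ) (v : Fin n → ℂ) (i : Fin m) (j : Fin n) :
    onVertex i j (R c (u i) (v j)) = Matrix.reindexAlgEquiv ℂ ℂ (lineEquiv m n)
      (siteR c (Sum.elim u v) (Sum.inl i) (Sum.inr j)) := by
  ext p q
  have h1 : p = q ↔ ((∀ k, k ≠ i → p.1 k = q.1 k) ∧ (∀ l, l ≠ j → p.2 l = q.2 l)) ∧
      (p.1 i, p.2 j) = (q.1 i, q.2 j) := by
    simp only [Prod.ext_iff, funext_iff]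
    grind
  have h2 : (lineEquiv m n).symm q = (lineEquiv m n).symm p ∘ Equiv.swap (Sum.inl i) (Sum.inr j) ↔
      ((∀ k, k ≠ i → p.1 k = q.1 k) ∧ (∀ l, l ≠ j → p.2 l = q.2 l)) ∧
      (p.1 i, p.2 j) = (q.1 i, q.2 j).swap := by
    have hi : ∀ k, Equiv.swap (Sum.inl i : Fin m ⊕ Fin n) (Sum.inr j) (Sum.inl k) =
        if k = i then Sum.inr j else Sum.inl k := fun k => by
      simp [Equiv.swap_apply_def]
    have hj : ∀ k, Equiv.swap (Sum.inl i : Fin m ⊕ Fin n) (Sum.inr j) (Sum.inr k) =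
        if k = j then Sum.inl i else Sum.inr k := fun k => by
      simp [Equiv.swap_apply_def]
    simp only [funext_iff, Sum.forall, Function.comp_apply, hi, hj, apply_ite
      ((lineEquiv m n).symm p), lineEquiv_symm_inl, lineEquiv_symm_inr, Prod.swap_prod_mk,
      Prod.mk.injEq]
    grind
  simp only [onVertex, R, permOp, siteR, sitePerm, Matrix.coe_reindexAlgEquiv,
    Matrix.reindex_apply, Matrix.submatrix_apply, Matrix.add_apply, Matrix.smul_apply,
    Matrix.one_apply, EmbeddingLike.apply_eq_iff_eq, h1, h2, Sum.elim_inl, Sum.elim_inr]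
  by_cases H : (∀ k, k ≠ i → p.1 k = q.1 k) ∧ (∀ l, l ≠ j → p.2 l = q.2 l)
  · simp only [if_pos H, and_iff_right H]
  · simp only [H, false_and, if_false, smul_zero, add_zero]

theorem commute_onVertex {m n : ℕ} (c : ℂ) (u : Fin m → ℂ) (v : Fin n → ℂ) {i i' : Fin m}
    {j j' : Fin n} (hi : i ≠ i') (hj : j ≠ j') :
    Commute (onVertex i j (R c (u i) (v j))) (onVertex i' j' (R c (u i') (v j'))) := by
  rw [onVertex_R_eq, onVertex_R_eq]
  exact (commute_siteR c _ (by simpa using hi) (by simp) (by simp) (by simpa using hj)).map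
    (Matrix.reindexAlgEquiv ℂ ℂ (lineEquiv m n))

theorem latticeMatrix_eq {m n : ℕ} (c : ℂ) (u : Fin m → ℂ) (v : Fin n → ℂ) :
    latticeMatrix c u v = Matrix.reindexAlgEquiv ℂ ℂ (lineEquiv m n)
      (siteLattice c (Sum.elim u v) ((List.finRange m).map Sum.inl)
        ((List.finRange n).map Sum.inr)) := by
  simp only [latticeMatrix, siteLattice, map_list_prod, List.map_map, List.ofFn_eq_map]
  refine congrArg List.prod (List.map_congr_left fun i _ => ?_)
  simp only [Function.comp_apply, siteRow, map_list_prod, List.map_map]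
  exact congrArg List.prod (List.map_congr_left fun j _ => onVertex_R_eq c u v i j)

theorem walls_eq {m n : ℕ} (x y : Fin 2 → ℂ) :
    walls m n x y = siteWall (Sum.elim (fun _ => x) fun _ => y) ∘ (lineEquiv m n).symm := by
  ext p
  simp only [walls, wall, siteWall, Function.comp_apply, Fintype.prod_sum_type, Sum.elim_inl,
    Sum.elim_inr, lineEquiv_symm_inl, lineEquiv_symm_inr]

theorem walls_eq_sitePF {m n : ℕ} (c : ℂ) (u : Fin m → ℂ) (v : Fin n → ℂ) (w e s ν : Fin 2 → ℂ) :
    walls m n w s ⬝ᵥ (latticeMatrix c u v *ᵥ walls m n e ν) =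
      sitePF c (Sum.elim u v) ((List.finRange m).map Sum.inl) ((List.finRange n).map Sum.inr)
        (Sum.elim (fun _ => w) fun _ => s) (Sum.elim (fun _ => e) fun _ => ν) := by
  rw [latticeMatrix_eq, walls_eq, walls_eq, Matrix.coe_reindexAlgEquiv, Matrix.reindex_apply,
    Matrix.submatrix_mulVec_equiv, comp_equiv_dotProduct_comp_equiv]
  simp [sitePF, Function.comp_assoc]

/-- The permutation is symmetric in its two spaces, and `(x - y) / c = (y - x) / (-c)`. -/
theorem R_symm (c x y : ℂ) (a b a' b' : Fin 2) :
    R c x y (a, b) (a', b') = R (-c) y x (b, a) (b', a') := by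
  simp only [R, permOp, Matrix.add_apply, Matrix.smul_apply, Matrix.one_apply, Prod.mk.injEq,
    Prod.swap_prod_mk, ← neg_sub x y, neg_div_neg_eq, and_comm]

theorem onVertex_symm {m n : ℕ} (c x y : ℂ) (i : Fin m) (j : Fin n) :
    onVertex i j (R c x y) = Matrix.reindexAlgEquiv ℂ ℂ (Equiv.prodComm _ _)
      (onVertex j i (R (-c) y x)) := by
  ext p q
  simp only [onVertex, Matrix.coe_reindexAlgEquiv, Matrix.reindex_apply,
    Matrix.submatrix_apply, Equiv.prodComm_symm, Equiv.prodComm_apply, Prod.fst_swap,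
    Prod.snd_swap, R_symm c x y]
  simp only [and_comm]

theorem latticeMatrix_symm {m n : ℕ} (c : ℂ) (u : Fin m → ℂ) (v : Fin n → ℂ) :
    latticeMatrix c u v = Matrix.reindexAlgEquiv ℂ ℂ (Equiv.prodComm _ _)
      (latticeMatrix (-c) v u) := by
  rw [latticeMatrix, latticeMatrix]
  simp only [List.ofFn_eq_map, map_list_prod, List.map_map, Function.comp_def, ← onVertex_symm]
  exact list_prod_prod_comm _ _ _ (List.nodup_finRange m) (List.nodup_finRange n)
    fun i _ i' _ j _ j' _ hi hj => commute_onVertex c u v hi hj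

theorem colMonodromy_eq {m : ℕ} (c y : ℂ) (u : Fin m → ℂ) :
    colMonodromy c y u = Matrix.reindexAlgEquiv ℂ ℂ (Equiv.prodComm _ _)
      (rowMonodromy (-c) y u) := by
  simp only [colMonodromy, rowMonodromy, List.ofFn_eq_map, map_list_prod, List.map_map,
    Function.comp_def, ← onVertex_symm]

theorem onCol_eq_reindex {m n : ℕ} (j : Fin n) (X : Matrix (Fin 2) (Fin 2) ℂ) :
    (onCol j X : Matrix (Conf m n) (Conf m n) ℂ) =
      Matrix.reindexAlgEquiv ℂ ℂ (Equiv.prodComm _ _) (onRow j X) := by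
  ext p q
  simp [onCol, onRow]

theorem colTransfer_eq {m : ℕ} (c y : ℂ) (u : Fin m → ℂ) (Bh : Matrix (Fin 2) (Fin 2) ℂ) :
    colTransfer c u Bh y = rowTransfer (-c) u Bh y := by
  ext α β
  simp only [colTransfer, rowTransfer, colMonodromy_eq, onCol_eq_reindex, ← map_mul]
  rfl

theorem walls_symm {m n : ℕ} (c : ℂ) (u : Fin m → ℂ) (v : Fin n → ℂ) (w e s ν : Fin 2 → ℂ) :
    walls m n w s ⬝ᵥ (latticeMatrix c u v *ᵥ walls m n e ν) =
      walls n m s w ⬝ᵥ (latticeMatrix (-c) v u *ᵥ walls n m ν e) := by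
  have h : ∀ x y, walls m n x y = walls n m y x ∘ (Equiv.prodComm _ _).symm := by
    intro x y
    ext p
    exact mul_comm _ _
  rw [latticeMatrix_symm, h, h, Matrix.coe_reindexAlgEquiv, Matrix.reindex_apply,
    Matrix.submatrix_mulVec_equiv, comp_equiv_dotProduct_comp_equiv]
  simp [Function.comp_assoc]

end Exchange

/-! ### The closed formulas -/

section ClosedFormulas

theorem siteSum_eq_sum_univ {ι : Type*} [DecidableEq ι] {m n : ℕ} (c b : ℂ) (z : ι → ℂ)
    (φ : Fin m → ι) (ψ : Fin n ↪ ι) :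
    siteSum c b z ((List.finRange m).map φ) ((List.finRange n).map ψ).toFinset =
      ∑ I : Finset (Fin n), b ^ Iᶜ.card *
        (∏ i, rowWeight c (z ∘ ψ) Finset.univ I (z (φ i))) *
        splitWeight c (z ∘ ψ) Finset.univ I := by
  have hC : ((List.finRange n).map ψ).toFinset = Finset.univ.map ψ := by
    ext k
    simp
  rw [siteSum, hC]
  symm
  have hsd : ∀ I : Finset (Fin n), Finset.univ.map ψ \ I.map ψ = Iᶜ.map ψ := fun I => by
    rw [← Finset.map_sdiff, Finset.compl_eq_univ_sdiff]
  refine Finset.sum_bij (fun I _ => I.map ψ) ?_ ?_ ?_ ?_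
  · intro I _
    exact Finset.mem_powerset.2 (Finset.map_subset_map.2 (Finset.subset_univ I))
  · intro I _ J _ h
    exact Finset.map_injective ψ h
  · intro J hJ
    obtain ⟨I, _, rfl⟩ := Finset.subset_map_iff.1 (Finset.mem_powerset.1 hJ)
    exact ⟨I, Finset.mem_univ _, rfl⟩
  · intro I _
    rw [hsd, Finset.card_map]
    congr 1
    · congr 1
      rw [List.map_map, ← List.ofFn_eq_map, List.prod_ofFn]
      refine Finset.prod_congr rfl fun i _ => ?_
      simp only [Function.comp_apply, rowWeight, hsd, Finset.prod_map,
        Finset.compl_eq_univ_sdiff]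
    · simp only [splitWeight, hsd, Finset.prod_map, Function.comp_apply,
        Finset.compl_eq_univ_sdiff]

theorem rowWeight_eq {n : ℕ} (c : ℂ) (hc : c ≠ 0) (v : Fin n → ℂ) (I : Finset (Fin n)) (a : ℂ)
    (ha : ∀ j, a ≠ v j) :
    rowWeight c v Finset.univ I a = (∏ j, 1 / g c a (v j)) * ∏ j ∈ I, f c a (v j) := by
  rw [rowWeight, ← Finset.prod_sdiff (Finset.subset_univ I), mul_assoc, ← Finset.prod_mul_distrib,
    mul_comm]
  congr 1
  · exact Finset.prod_congr rfl fun j _ => by rw [g, one_div_div]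
  · refine Finset.prod_congr rfl fun j _ => ?_
    have := sub_ne_zero.2 (ha j)
    rw [g, f]
    field_simp

theorem g_neg (c a b : ℂ) : g (-c) a b = g c b a := by
  rw [g, g, ← neg_sub b a, neg_div_neg_eq]

/-- Conjugating the transpose by `σ_y` gives the adjugate `tr(Bh) - Bh`, so `χ` is `tr B · tr Bh /
tr (B Bh)`. -/
theorem chi_mul_trace (B Bh : Matrix (Fin 2) (Fin 2) ℂ) (h : (B * Bh).trace ≠ 0) :
    chi B Bh * (B * Bh).trace = B.trace * Bh.trace := by
  have key : (B * sigmaY * Bhᵀ * sigmaY).trace = B.trace * Bh.trace - (B * Bh).trace := by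
    simp only [Matrix.trace_fin_two, Matrix.mul_apply, Fin.sum_univ_two, sigmaY,
      Matrix.transpose_apply, Matrix.of_apply, Matrix.cons_val', Matrix.cons_val_zero,
      Matrix.cons_val_one, Matrix.cons_val_fin_one]
    ring_nf
    rw [Complex.I_sq]
    ring
  rw [chi, beta, key]
  field_simp
  ring

theorem walls_eq_sum_columns {m n : ℕ} (c : ℂ) (hc : c ≠ 0) (u : Fin m → ℂ) (v : Fin n → ℂ)
    (w e s ν : Fin 2 → ℂ) (huv : ∀ i j, u i ≠ v j) (χ : ℂ) (hp : w ⬝ᵥ e ≠ 0) (hq : s ⬝ᵥ ν ≠ 0)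
    (hχ0 : χ ≠ 0) (hχ : χ * ((s ⬝ᵥ e) * (w ⬝ᵥ ν)) = (w ⬝ᵥ e) * (s ⬝ᵥ ν))
    (hv : Function.Injective v) :
    walls m n w s ⬝ᵥ (latticeMatrix c u v *ᵥ walls m n e ν) =
      (w ⬝ᵥ e) ^ m * (s ⬝ᵥ ν) ^ n / χ ^ n * lambda2 c u v *
        ∑ I : Finset (Fin n), (χ - 1) ^ (Iᶜ.card) * (∏ i, ∏ j ∈ I, f c (u i) (v j)) *
          (∏ j ∈ I, ∏ k ∈ Iᶜ, f c (v j) (v k)) := by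
  rw [walls_eq_sitePF, sitePF_eq_siteSum c hc w e s ν χ hp hq hχ0 hχ]
  · have h : siteSum c (χ - 1) (Sum.elim u v) ((List.finRange m).map Sum.inl)
        ((List.finRange n).map Sum.inr).toFinset =
        ∑ I : Finset (Fin n), (χ - 1) ^ Iᶜ.card * (∏ i, rowWeight c v Finset.univ I (u i)) *
          splitWeight c v Finset.univ I :=
      siteSum_eq_sum_univ c (χ - 1) (Sum.elim u v) Sum.inl Function.Embedding.inr
    rw [h, Fintype.prod_sum_type, mul_assoc _ (lambda2 c u v),
      Finset.mul_sum _ _ (lambda2 c u v)]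
    congr 1
    · simp
    · refine Finset.sum_congr rfl fun I _ => ?_
      simp only [rowWeight_eq c hc v I _ (huv _), Finset.prod_mul_distrib,
        splitWeight, Finset.compl_eq_univ_sdiff, lambda2]
      ring
  · exact (List.nodup_finRange m).map Sum.inl_injective
  · exact (List.nodup_finRange n).map Sum.inr_injective
  · simp
  · simp
  · simp
  · simpa using fun j k h => hv h

theorem walls_eq_sum_rows {m n : ℕ} (c : ℂ) (hc : c ≠ 0) (u : Fin m → ℂ) (v : Fin n → ℂ)
    (w e s ν : Fin 2 → ℂ) (huv : ∀ i j, u i ≠ v j) (χ : ℂ) (hp : w ⬝ᵥ e ≠ 0) (hq : s ⬝ᵥ ν ≠ 0)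
    (hχ0 : χ ≠ 0) (hχ : χ * ((s ⬝ᵥ e) * (w ⬝ᵥ ν)) = (w ⬝ᵥ e) * (s ⬝ᵥ ν))
    (hu : Function.Injective u) :
    walls m n w s ⬝ᵥ (latticeMatrix c u v *ᵥ walls m n e ν) =
      (w ⬝ᵥ e) ^ m * (s ⬝ᵥ ν) ^ n / χ ^ m * lambda2 c u v *
        ∑ I : Finset (Fin m), (χ - 1) ^ I.card * (∏ i ∈ Iᶜ, ∏ j, f c (u i) (v j)) *
          (∏ i ∈ I, ∏ k ∈ Iᶜ, f c (u i) (u k)) := by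
  -- The relation defining `χ` is symmetric under the exchange of rows and columns, so the same `χ`
  -- serves here.
  rw [walls_symm, walls_eq_sum_columns (-c) (neg_ne_zero.2 hc) v u s ν w e
    (fun j i => (huv i j).symm) χ hq hp hχ0 (by rw [mul_comm (w ⬝ᵥ ν), hχ, mul_comm]) hu]
  simp only [f_neg, lambda2, g_neg]
  rw [Finset.prod_comm, mul_comm ((s ⬝ᵥ ν) ^ n)]
  congr 1
  -- The sign of `c` reverses the arguments of `f`, which exchanges the roles of a subset and its
  -- complement.
  refine Finset.sum_bij' (fun I _ => Iᶜ) (fun I _ => Iᶜ) (by simp) (by simp) (by simp) (by simp)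
    fun I _ => ?_
  rw [compl_compl, Finset.prod_comm, Finset.prod_comm (s := Iᶜ) (t := I)]

end ClosedFormulas

/-! ### The determinants as subset sums, and the main theorem. -/

theorem modifiedIzergin_eq_sum {m n : ℕ} (c : ℂ) (hc : c ≠ 0) (z : ℂ) (u : Fin m → ℂ)
    (v : Fin n → ℂ) (hv : Function.Injective v) (h0 : ∀ j k, v j - v k + c ≠ 0) :
    modifiedIzergin c z u v = ∑ I : Finset (Fin n), (-z) ^ (Iᶜ.card) *
      (∏ i, ∏ j ∈ I, f c (u i) (v j)) * (∏ j ∈ I, ∏ k ∈ Iᶜ, f c (v j) (v k)) := by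
  have h := det_add_cauchy c hc v hv h0 (fun _ => -z) fun j => ∏ i, f c (u i) (v j)
  simp only [Finset.prod_const] at h
  simp only [modifiedIzergin, mul_ite, mul_one, mul_zero, h]
  exact Finset.sum_congr rfl fun I _ => by rw [Finset.prod_comm]

theorem dualDet_eq_sum {m n : ℕ} (c : ℂ) (hc : c ≠ 0) (z : ℂ) (u : Fin m → ℂ)
    (v : Fin n → ℂ) (hu : Function.Injective u) (h0 : ∀ j k, u j - u k + c ≠ 0) :
    dualDet c z u v = ∑ I : Finset (Fin m), (-z) ^ I.card *
      (∏ i ∈ Iᶜ, ∏ j, f c (u i) (v j)) * (∏ i ∈ I, ∏ k ∈ Iᶜ, f c (u i) (u k)) := by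
  have h := det_add_cauchy c hc u hu h0 (fun i => ∏ j, f c (u i) (v j)) fun _ => -z
  simp only [Finset.prod_const] at h
  simp only [dualDet, ite_mul, one_mul, zero_mul, sub_eq_add_neg, ← mul_div_assoc, ← neg_div,
    ← neg_mul, h]
  exact Finset.sum_congr rfl fun I _ => by rw [mul_comm ((-z) ^ _)]

theorem trace_vecMulVec_mul_vecMulVec (w e s ν : Fin 2 → ℂ) :
    (Matrix.vecMulVec e w * Matrix.vecMulVec ν s).trace = (s ⬝ᵥ e) * (w ⬝ᵥ ν) := by
  simp only [Matrix.trace_fin_two, Matrix.mul_apply, Fin.sum_univ_two, Matrix.vecMulVec_apply,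
    dotProduct]
  ring

end SixVertex

end

open SixVertex in
theorem mainTheorem1 (m n : ℕ) (c : ℂ) (hc : c ≠ 0) (u : Fin m → ℂ) (v : Fin n → ℂ)
    (w e nn s : Fin 2 → ℂ) (B Bh : Matrix (Fin 2) (Fin 2) ℂ)
    (hB : B = Matrix.vecMulVec e w) (hBh : Bh = Matrix.vecMulVec nn s) :
    -- the model with four walls
    partitionFunction c u v B Bh =
        (fun p : Conf m n => wall m w p.1 * wall n s p.2) ⬝ᵥ
          (latticeMatrix c u v).mulVec (fun p : Conf m n => wall m e p.1 * wall n nn p.2) ∧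
    partitionFunction c u v B Bh =
        wall n s ⬝ᵥ
          ((List.ofFn fun i => rowTransfer c v B (u i)).prod).mulVec (wall n nn) ∧
    partitionFunction c u v B Bh =
        wall m w ⬝ᵥ
          ((List.ofFn fun j => colTransfer c u Bh (v j)).prod).mulVec (wall m e) ∧
    -- the closed formulas, away from the poles
    ((∀ i j, u i ≠ v j) → B.trace ≠ 0 → Bh.trace ≠ 0 → (B * Bh).trace ≠ 0 →
      -- the modified Izergin determinant, of size `n`
      (Function.Injective v → (∀ j k, v j - v k + c ≠ 0) →
        partitionFunction c u v B Bh =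
          B.trace ^ m * Bh.trace ^ n / chi B Bh ^ n * lambda2 c u v *
            modifiedIzergin c (beta B Bh) u v) ∧
      -- the determinant of size `m`
      (Function.Injective u → (∀ j k, u j - u k + c ≠ 0) →
        partitionFunction c u v B Bh =
          B.trace ^ m * Bh.trace ^ n / chi B Bh ^ m * lambda2 c u v *
            dualDet c (beta B Bh) u v) ∧
      -- the sum over partitions of `v` into `I` and its complement
      (Function.Injective v →
        partitionFunction c u v B Bh =
          B.trace ^ m * Bh.trace ^ n / chi B Bh ^ n * lambda2 c u v *
            ∑ I : Finset (Fin n), (-beta B Bh) ^ (Iᶜ.card) *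
              (∏ i, ∏ j ∈ I, f c (u i) (v j)) * (∏ j ∈ I, ∏ k ∈ Iᶜ, f c (v j) (v k))) ∧
      -- the sum over partitions of `u` into `I` and its complement
      (Function.Injective u →
        partitionFunction c u v B Bh =
          B.trace ^ m * Bh.trace ^ n / chi B Bh ^ m * lambda2 c u v *
            ∑ I : Finset (Fin m), (-beta B Bh) ^ (I.card) *
              (∏ i ∈ Iᶜ, ∏ j, f c (u i) (v j)) * (∏ i ∈ I, ∏ k ∈ Iᶜ, f c (u i) (u k)))) := by
  subst hB hBh
  have hwalls := partitionFunction_eq_walls c u v w e s nn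
  refine ⟨hwalls, ?_, ?_, ?_⟩
  · rw [hwalls, walls_dotProduct_mulVec, contractRows_latticeMatrix]
  · rw [hwalls, walls_symm, walls_dotProduct_mulVec, contractRows_latticeMatrix]
    simp only [colTransfer_eq]
  · intro huv hp hq ht
    have hχ := chi_mul_trace _ _ ht
    have hχ0 : chi (Matrix.vecMulVec e w) (Matrix.vecMulVec nn s) ≠ 0 := fun h0 =>
      mul_ne_zero hp hq (by rw [← hχ, h0, zero_mul])
    have hb : -beta (Matrix.vecMulVec e w) (Matrix.vecMulVec nn s) =
        chi (Matrix.vecMulVec e w) (Matrix.vecMulVec nn s) - 1 := by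
      rw [chi]
      ring
    have hB : (Matrix.vecMulVec e w).trace = w ⬝ᵥ e := by
      rw [Matrix.trace_vecMulVec, dotProduct_comm]
    have hBh : (Matrix.vecMulVec nn s).trace = s ⬝ᵥ nn := by
      rw [Matrix.trace_vecMulVec, dotProduct_comm]
    rw [trace_vecMulVec_mul_vecMulVec, hB, hBh] at hχ
    rw [hB] at hp ⊢
    rw [hBh] at hq ⊢
    rw [hwalls]
    have hcols := walls_eq_sum_columns c hc u v w e s nn huv _ hp hq hχ0 hχ
    have hrows := walls_eq_sum_rows c hc u v w e s nn huv _ hp hq hχ0 hχ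
    rw [hb]
    refine ⟨fun hv h0 => ?_, fun hu h0 => ?_, hcols, hrows⟩
    · rw [modifiedIzergin_eq_sum c hc _ u v hv h0, hb]
      exact hcols hv
    · rw [dualDet_eq_sum c hc _ u v hu h0, hb]
      exact hrows hu
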